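/- Let $\Theta$ be a $\mathfrak G$-theory, i.e. a small category with finite products and a zero object, equipped with a set $S$ of objects (sorts) such that every object is a finite product of sorts, and with a group structure at each sort. Let $\Theta\text{-}\mathrm{Alg}$ be the category of $\Theta$-algebras (finite-product-preserving functors from $\Theta$ to pointed sets, equivalently to sets), let $X$ be a $\Theta$-algebra, put $\mathcal C=\Theta\text{-}\mathrm{Alg}/X$, and let $n\ge 1$. For an abelian group object $G$ of $\mathcal C$, an *extended Eilenberg–Mac Lane object* $E^X(G,n)$ is an abelian group object $E$ of $s\mathcal C$ whose homotopy groups, taken fibrewise over $X$ along the zero section, vanish in all degrees $\ne n$ (so $\pi_0E\cong X$), together with an isomorphism $\pi_nE\cong G$ of abelian group objects over $X$. A *free simplicial resolution* of $Y\in s\mathcal C$ (for instance a constant $Y\in\mathcal C$) is a weak equivalence $V\to Y$ in $s\mathcal C$ with $V$ cofibrant, i.e. $V$ is a retract of a free simplicial object; weak equivalences are the maps inducing isomorphisms on the homotopy groups of the underlying $S$-graded simplicial groups. Then: 1. There is a functor $G\mapsto E^X(G,n)$ from abelian group objects of $\mathcal C$ to abelian group objects of $s\mathcal C$ that assigns to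 each $G$ an extended Eilenberg–Mac Lane object, with $\pi_nE^X(G,n)\cong G$ naturally in $G$. 2. For all free simplicial resolutions $V\to Y$ and all extended Eilenberg–Mac Lane objects $E^X(G,n)$ there is an isomorphism of abelian groups $$H^n\bigl(\operatorname{Hom}_{\mathcal C}(V_\bullet,G)\bigr)\;\cong\;\pi_0\operatorname{map}_{s\mathcal C}\bigl(V_\bullet,E^X(G,n)\bigr)$$ between the $n$-th André–Quillen cohomology group of $Y$ with coefficients in $G$ (the $n$-th cohomology of the cochain complex of the cosimplicial abelian group $\operatorname{Hom}_{\mathcal C}(V_\bullet,G)$) and the group of components of the function complex of simplicial maps over $X$. It is natural in $V$ (for all maps $V\to V'$ between such resolutions) and in the coefficients (for all homomorphisms $g:G\to G'$ and $e:E^X(G,n)\to E^X(G',n)$ such that $\pi_n(e)$ corresponds to $g$). -/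

import Mathlib

open CategoryTheory Limits Opposite Simplicial

universe w v u

noncomputable section

/-! ### Abelian group objects -/

/-- An abelian group object in a category `C`: an object together with a natural abelian group
structure on `Hom(Y, obj)`, for all `Y` (that is, a lift of the represented functor to abelian
groups). -/
structure AbObj (C : Type u) [Category.{v} C] where
  obj : C
  [grp : ∀ Y : C, AddCommGroup (Y ⟶ obj)]
  comp_add : ∀ {Y Y' : C} (f : Y' ⟶ Y) (a b : Y ⟶ obj), f ≫ (a + b) = f ≫ a + f ≫ b

namespace AbObj

variable {C : Type u} [Category.{v} C]

attribute [instance] AbObj.grp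

/-- Homomorphisms of abelian group objects. -/
@[ext]
structure Hom (G H : AbObj C) where
  hom : G.obj ⟶ H.obj
  add_comp : ∀ {Y : C} (a b : Y ⟶ G.obj), (a + b) ≫ hom = a ≫ hom + b ≫ hom

instance : Category (AbObj C) where
  Hom := Hom
  id G := ⟨𝟙 G.obj, by simp⟩
  comp f g := ⟨f.hom ≫ g.hom, fun a b => by
    rw [← Category.assoc, f.add_comp, g.add_comp, Category.assoc, Category.assoc]⟩

@[simp] lemma id_hom (G : AbObj C) : Hom.hom (𝟙 G) = 𝟙 G.obj := rfl

@[simp] lemma comp_hom {G H K : AbObj C} (f : G ⟶ H) (g : H ⟶ K) :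
    (f ≫ g).hom = f.hom ≫ g.hom := rfl

@[ext] lemma hom_ext {G H : AbObj C} {f g : G ⟶ H} (h : f.hom = g.hom) : f = g := Hom.ext h

/-- The functor forgetting the group structure. -/
def forget (C : Type u) [Category.{v} C] : AbObj C ⥤ C where
  obj G := G.obj
  map f := f.hom

/-- The abelian group `Hom(Y, G)`, contravariantly functorial in `Y` and functorial in `G`. -/
def homGroup (C : Type u) [Category.{v} C] : Cᵒᵖ ⥤ AbObj C ⥤ AddCommGrpCat.{v} where
  obj Y :=
    { obj G := AddCommGrpCat.of (Y.unop ⟶ G.obj)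
      map g := AddCommGrpCat.ofHom (AddMonoidHom.mk' (fun a => a ≫ g.hom) g.add_comp)
      map_id G := by ext; simp
      map_comp f g := by ext; simp }
  map f :=
    { app G := AddCommGrpCat.ofHom (AddMonoidHom.mk' (fun a => f.unop ≫ a) (G.comp_add f.unop))
      naturality G H g := by ext; simp }
  map_id Y := by ext; simp
  map_comp f g := by ext; simp

end AbObj

/-! ### Cohomology of the cosimplicial abelian group `Hom(V, G)` -/

section Cohomology

variable {C : Type u} [Category.{v} C]

/-- The cosimplicial abelian group `Hom(V, G)`, for a simplicial object `V` of `C` and an abelian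
group object `G` of `C`. -/
def cosimplicialHom (V : SimplicialObject C) (G : AbObj C) : CosimplicialObject AddCommGrpCat.{v} :=
  Functor.rightOp V ⋙ (AbObj.homGroup C).flip.obj G

/-- The map of cosimplicial abelian groups induced by `a : V ⟶ V'` and `g : G ⟶ G'`. -/
def cosimplicialHomMap {V V' : SimplicialObject C} {G G' : AbObj C} (a : V ⟶ V') (g : G ⟶ G') :
    cosimplicialHom V' G ⟶ cosimplicialHom V G' where
  app k := ((AbObj.homGroup C).map (a.app (op k)).op).app G ≫
    ((AbObj.homGroup C).obj (op (V.obj (op k)))).map g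
  naturality k l f := by
    ext (x : V'.obj (op k) ⟶ G.obj)
    change (a.app (op l) ≫ V'.map f.op ≫ x) ≫ g.hom = V.map f.op ≫ (a.app (op k) ≫ x) ≫ g.hom
    simp only [Category.assoc, NatTrans.naturality_assoc]

/-- The `n`-th cohomology group of the cochain complex associated with the cosimplicial abelian
group `Hom(V, G)`. When `V` is a free simplicial resolution of `Y`, this is the `n`-th
André–Quillen cohomology group of `Y` with coefficients in `G`. -/
def derivedCohomology (n : ℕ) (V : SimplicialObject C) (G : AbObj C) : AddCommGrpCat.{v} :=
  ((AlgebraicTopology.alternatingCofaceMapComplex AddCommGrpCat.{v}).obj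
    (cosimplicialHom V G)).homology n

/-- Functoriality of `derivedCohomology`. -/
def derivedCohomologyMap (n : ℕ) {V V' : SimplicialObject C} {G G' : AbObj C}
    (a : V ⟶ V') (g : G ⟶ G') : derivedCohomology n V' G ⟶ derivedCohomology n V G' :=
  HomologicalComplex.homologyMap
    ((AlgebraicTopology.alternatingCofaceMapComplex AddCommGrpCat.{v}).map
      (cosimplicialHomMap a g)) n

end Cohomology

/-! ### Components of function complexes into simplicial abelian group objects -/

section Components

/-- The simplicial set underlying a simplicial abelian group. -/
abbrev underlyingSSet (M : SimplicialObject AddCommGrpCat.{w}) : SSet.{w} :=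
  ((SimplicialObject.whiskering _ _).obj (CategoryTheory.forget AddCommGrpCat.{w})).obj M

variable (M : SimplicialObject AddCommGrpCat.{w})

/-- The component of a vertex of a simplicial abelian group. -/
abbrev component (x : M _⦋0⦌) : SSet.π₀ (underlyingSSet M) := SSet.π₀.mk x

lemma component_face (z : M _⦋1⦌) : component M (M.δ 1 z) = component M (M.δ 0 z) :=
  SSet.π₀.sound (SSet.Edge.mk' (X := underlyingSSet M) z)

lemma component_ind {p : SSet.π₀ (underlyingSSet M) → Prop} (h : ∀ x, p (component M x)) (a) :
    p a := by
  obtain ⟨x, rfl⟩ := SSet.π₀.mk_surjective a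
  exact h x

/-- Maps out of the set of components are given by functions on vertices that identify the two
ends of each edge. -/
def componentLift {T : Type*} (f : M _⦋0⦌ → T) (hf : ∀ z : M _⦋1⦌, f (M.δ 1 z) = f (M.δ 0 z)) :
    SSet.π₀ (underlyingSSet M) → T :=
  SSet.π₀.lift (X := underlyingSSet M) f (fun x₀ x₁ e => by
    have h := hf e.edge
    have h₁ : M.δ 1 e.edge = x₀ := e.src_eq
    have h₀ : M.δ 0 e.edge = x₁ := e.tgt_eq
    rwa [h₁, h₀] at h)

lemma component_add_face (x : M _⦋0⦌) (z : M _⦋1⦌) :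
    component M (x + M.δ 1 z) = component M (x + M.δ 0 z) := by
  have h := component_face M (M.σ 0 x + z)
  have h₁ : M.δ 1 (M.σ 0 x) = x := 
    ConcreteCategory.congr_hom (SimplicialObject.δ_comp_σ_succ M (i := (0 : Fin 1))) x
  have h₀ : M.δ 0 (M.σ 0 x) = x := 
    ConcreteCategory.congr_hom (SimplicialObject.δ_comp_σ_self M (i := (0 : Fin 1))) x
  rwa [map_add, map_add, h₁, h₀] at h

instance : Add (SSet.π₀ (underlyingSSet M)) := ⟨fun a b =>
  componentLift M (fun x => componentLift M (fun y => component M (x + y))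
    (component_add_face M x) b)
    (fun z => by
      induction b using component_ind with | _ y
      change component M (M.δ 1 z + y) = component M (M.δ 0 z + y)
      rw [add_comm, component_add_face, add_comm]) a⟩

instance : Zero (SSet.π₀ (underlyingSSet M)) := ⟨component M 0⟩

instance : Neg (SSet.π₀ (underlyingSSet M)) := ⟨componentLift M (fun x => component M (-x))
  (fun z => by
    have h := component_face M (-z)
    rwa [map_neg, map_neg] at h)⟩

/-- The set of components of a simplicial abelian group is an abelian group, with the operations
induced by those on vertices: `[x] + [y] = [x + y]`. -/
instance componentsAddCommGroup : AddCommGroup (SSet.π₀ (underlyingSSet M)) where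
  nsmul := nsmulRec
  zsmul := zsmulRec
  add_assoc a b c := by
    induction a using component_ind with | _ x
    induction b using component_ind with | _ y
    induction c using component_ind with | _ z
    change component M (x + y + z) = component M (x + (y + z))
    rw [add_assoc]
  zero_add a := by
    induction a using component_ind with | _ x
    change component M (0 + x) = component M x
    rw [zero_add]
  add_zero a := by
    induction a using component_ind with | _ x
    change component M (x + 0) = component M x
    rw [add_zero]
  neg_add_cancel a := by
    induction a using component_ind with | _ x
    change component M (-x + x) = component M 0
    rw [neg_add_cancel]
  add_comm a b := by
    induction a using component_ind with | _ x
    induction b using component_ind with | _ y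
    change component M (x + y) = component M (y + x)
    rw [add_comm]

lemma component_add (x y : M _⦋0⦌) : component M (x + y) = component M x + component M y := rfl

end Components

section MappingSpace

variable {C : Type u} [Category.{v} C]

/-- The simplicial object underlying a simplicial abelian group object. -/
abbrev forgetAb (E : SimplicialObject (AbObj C)) : SimplicialObject C :=
  ((SimplicialObject.whiskering _ _).obj (AbObj.forget C)).obj E

instance (E : SimplicialObject (AbObj C)) (k : SimplexCategoryᵒᵖ) (Y : C) :
    AddCommGroup (Y ⟶ (forgetAb E).obj k) :=
  (E.obj k).grp Y

lemma forgetAb_comp_add (E : SimplicialObject (AbObj C)) (k : SimplexCategoryᵒᵖ) {Y Y' : C}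
    (f : Y' ⟶ Y) (a b : Y ⟶ (forgetAb E).obj k) : f ≫ (a + b) = f ≫ a + f ≫ b :=
  (E.obj k).comp_add f a b

lemma forgetAb_add_comp (E : SimplicialObject (AbObj C)) {k l : SimplexCategoryᵒᵖ} (θ : k ⟶ l)
    {Y : C} (a b : Y ⟶ (forgetAb E).obj k) :
    (a + b) ≫ (forgetAb E).map θ = a ≫ (forgetAb E).map θ + b ≫ (forgetAb E).map θ :=
  (E.map θ).add_comp a b

section HomObj

variable (W : SimplicialObject C) (E : SimplicialObject (AbObj C)) (A : SimplexCategoryᵒᵖ ⥤ Type w)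

instance : Add (Functor.HomObj W (forgetAb E) A) := ⟨fun f g =>
  ⟨fun k a => f.app k a + g.app k a, fun {k l} θ a => by
    rw [forgetAb_comp_add, f.naturality, g.naturality, forgetAb_add_comp]⟩⟩

instance : Zero (Functor.HomObj W (forgetAb E) A) := ⟨⟨fun k a => 0, fun {k l} θ a => by
    have h₁ := forgetAb_comp_add E l (W.map θ) 0 0
    have h₂ := forgetAb_add_comp E θ (0 : W.obj k ⟶ (forgetAb E).obj k) 0
    rw [add_zero, left_eq_add] at h₁ h₂
    rw [h₁, h₂]⟩⟩

instance : Neg (Functor.HomObj W (forgetAb E) A) := ⟨fun f => ⟨fun k a => - f.app k a,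
  fun {k l} θ a => by
    have h₁ := forgetAb_comp_add E l (W.map θ) 0 0
    have h₂ := forgetAb_add_comp E θ (0 : W.obj k ⟶ (forgetAb E).obj k) 0
    have h₃ := forgetAb_comp_add E l (W.map θ) (- f.app l (A.map θ a)) (f.app l (A.map θ a))
    have h₄ := forgetAb_add_comp E θ (- f.app k a) (f.app k a)
    rw [add_zero, left_eq_add] at h₁ h₂
    rw [neg_add_cancel, h₁] at h₃
    rw [neg_add_cancel, h₂] at h₄
    rw [eq_neg_of_add_eq_zero_left h₃.symm, eq_neg_of_add_eq_zero_left h₄.symm,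
      f.naturality]⟩⟩

/-- An `A`-parametrised map `W ⊗ A ⟶ E` is a family of maps `W _⦋k⦌ ⟶ E _⦋k⦌` indexed by the
`k`-simplices of `A`; these are added pointwise. -/
instance homObjAddCommGroup : AddCommGroup (Functor.HomObj W (forgetAb E) A) where
  nsmul := nsmulRec
  zsmul := zsmulRec
  add_assoc f g h := Functor.HomObj.ext (by funext k a; exact add_assoc _ _ _)
  zero_add f := Functor.HomObj.ext (by funext k a; exact zero_add _)
  add_zero f := Functor.HomObj.ext (by funext k a; exact add_zero _)
  neg_add_cancel f := Functor.HomObj.ext (by funext k a; exact neg_add_cancel _)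
  add_comm f g := Functor.HomObj.ext (by funext k a; exact add_comm _ _)

end HomObj

/-- The function complex `map(W, E)` of a simplicial object `W` and a simplicial abelian group
object `E`, as a simplicial abelian group. -/
def mapGroup (W : SimplicialObject C) (E : SimplicialObject (AbObj C)) :
    SimplicialObject AddCommGrpCat.{v} where
  obj k := AddCommGrpCat.of (Functor.HomObj W (forgetAb E) (coyoneda.obj (op k)))
  map θ := AddCommGrpCat.ofHom (AddMonoidHom.mk' ((SimplicialCategory.sHom W (forgetAb E)).map θ)
    (fun f g => rfl))
  map_id k := by
    refine AddCommGrpCat.ext fun x => ?_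
    exact ConcreteCategory.congr_hom ((SimplicialCategory.sHom W (forgetAb E)).map_id k) x
  map_comp θ θ' := by
    refine AddCommGrpCat.ext fun x => ?_
    exact ConcreteCategory.congr_hom ((SimplicialCategory.sHom W (forgetAb E)).map_comp θ θ') x

/-- The simplicial set underlying `mapGroup W E` is the usual function complex. -/
lemma underlyingSSet_mapGroup (W : SimplicialObject C) (E : SimplicialObject (AbObj C)) :
    underlyingSSet (mapGroup W E) = SimplicialCategory.sHom W (forgetAb E) := rfl

/-- The abelian group `π₀ map(W, E)` of homotopy classes of maps from `W` to `E`. -/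
abbrev mapComponents (W : SimplicialObject C) (E : SimplicialObject (AbObj C)) : Type v :=
  SSet.π₀ (underlyingSSet (mapGroup W E))

/-- The map of function complexes `h ↦ a ≫ h ≫ e`, for `a : W ⟶ W'` and `e : E ⟶ E'`. -/
def mapGroupMap {W W' : SimplicialObject C} {E E' : SimplicialObject (AbObj C)}
    (a : W ⟶ W') (e : E ⟶ E') : mapGroup W' E ⟶ mapGroup W E' where
  app k := AddCommGrpCat.ofHom (AddMonoidHom.mk'
    (fun h : Functor.HomObj W' (forgetAb E) (coyoneda.obj (op k)) =>
      ((Functor.HomObj.ofNatTrans a).comp h).comp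
        (Functor.HomObj.ofNatTrans
          (((SimplicialObject.whiskering _ _).obj (AbObj.forget C)).map e)))
    (fun f g => Functor.HomObj.ext (by
      funext l α
      change (a.app l ≫ (f.app l α + g.app l α)) ≫ (e.app l).hom =
        (a.app l ≫ f.app l α) ≫ (e.app l).hom + (a.app l ≫ g.app l α) ≫ (e.app l).hom
      rw [forgetAb_comp_add]
      exact (e.app l).add_comp _ _)))
  naturality k k' θ := by
    ext h
    rfl

/-- The map `π₀ map(W', E) → π₀ map(W, E')` sending the class of `f` to that of `a ≫ f ≫ e`. -/
def mapComponentsMap {W W' : SimplicialObject C} {E E' : SimplicialObject (AbObj C)}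
    (a : W ⟶ W') (e : E ⟶ E') : mapComponents W' E → mapComponents W E' :=
  SSet.mapπ₀ (((SimplicialObject.whiskering _ _).obj (CategoryTheory.forget AddCommGrpCat.{v})).map
    (mapGroupMap a e))

end MappingSpace

/-! ### Theories and their algebras -/

section Theories

/-- The structure of a `𝔊`-theory on a small category `Θ` with (chosen) finite products and a zero
object: a set of sorts such that each object is a finite product of sorts, and a group structure
at each sort. -/
structure GroupTheory (Θ : Type w) [SmallCategory Θ] [CartesianMonoidalCategory Θ] where
  hasZeroObject : HasZeroObject Θ
  sorts : Set Θ
  exists_product : ∀ θ : Θ, ∃ (m : ℕ) (s : Fin m → sorts) (p : ∀ i, θ ⟶ (s i : Θ)),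
    Nonempty (IsLimit (Fan.mk θ p))
  grp : ∀ s : sorts, GrpObj (s : Θ)

/-- The category of `Θ`-algebras, i.e. finite-product-preserving functors from `Θ` to sets. If `Θ`
has a zero object `0`, such a functor takes values in pointed sets, and its natural
transformations are pointed: the base point of `A(θ)` is the image of the unique element of `A(0)`
under the zero map `0 ⟶ θ`. -/
abbrev ThetaAlg (Θ : Type w) [SmallCategory Θ] : Type (w + 1) :=
  ObjectProperty.FullSubcategory (fun A : Θ ⥤ Type w => PreservesFiniteProducts A)

variable {Θ : Type w} [SmallCategory Θ]

namespace ThetaAlg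

/-- The forgetful functor `A ↦ A(θ)`. -/
def ev (θ : Θ) : ThetaAlg Θ ⥤ Type w :=
  ObjectProperty.ι _ ⋙ (evaluation Θ (Type w)).obj θ

/-- The representable algebra `Hom(θ, -)`: maps from it to `A` are the elements of `A(θ)`. -/
def rep (θ : Θ) : ThetaAlg Θ :=
  ⟨coyoneda.obj (op θ), inferInstance⟩

variable (X : ThetaAlg Θ)

/-- For an element `x ∈ X(θ)`, the representable algebra `Hom(θ, -)` over `X` via the map
`Hom(θ, -) ⟶ X` corresponding to `x`. Maps over `X` from it to `p : Y ⟶ X` are the elements of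
the fibre of `p` over `x`. -/
def repOver : X.obj.Elementsᵒᵖ ⥤ Over X where
  obj e := Over.mk (Y := rep e.unop.1) (ObjectProperty.homMk (coyonedaEquiv.symm e.unop.2))
  map {e e'} f := Over.homMk (ObjectProperty.homMk (coyoneda.map f.unop.1.op)) (by
    apply ObjectProperty.hom_ext
    apply coyonedaEquiv.injective
    change X.obj.map (f.unop.1 ≫ 𝟙 _) e'.unop.2 = X.obj.map (𝟙 _) e.unop.2
    rw [Category.comp_id, f.unop.2, X.obj.map_id]
    rfl)
  map_id e := by
    ext θ x
    exact Category.id_comp (obj := Θ) x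
  map_comp f g := by
    ext θ x
    exact Category.assoc (obj := Θ) _ _ x

/-- An abelian group object `G` over `X` gives the functor sending `x ∈ X(θ)` to the abelian group
of elements of `G(θ)` lying over `x`. -/
def fibres : AbObj (Over X) ⥤ X.obj.Elements ⥤ AddCommGrpCat.{w} :=
  ((repOver X).rightOp ⋙ AbObj.homGroup (Over X)).flip

/-- The homotopy groups of a simplicial abelian group object `E` over `X`: the functor sending
`x ∈ X(θ)` to the `m`-th homotopy group (the homology of the normalized chain complex) of the
simplicial abelian group of elements of `E(θ)` lying over `x`. -/
def homotopy (m : ℕ) :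
    SimplicialObject (AbObj (Over X)) ⥤ X.obj.Elements ⥤ AddCommGrpCat.{w} :=
  (SimplicialObject.whiskering _ _).obj (fibres X) ⋙
    AlgebraicTopology.normalizedMooreComplex _ ⋙ HomologicalComplex.homologyFunctor _ _ m

/-- The structure of an extended Eilenberg–Mac Lane object `E^X(G, n)`, `n ≥ 1`, on a simplicial
abelian group object `E` over `X`: the homotopy groups along the zero section of `E ⟶ X` vanish in
degrees other than `n` (in particular `π₀ E ≅ X`), and `π_n E` is identified with `G`, compatibly
with the operations of `Θ`. -/
structure EilenbergMacLane (G : AbObj (Over X)) (n : ℕ) where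
  obj : SimplicialObject (AbObj (Over X))
  iso : (homotopy X n).obj obj ≅ (fibres X).obj G
  isZero : ∀ m, m ≠ n → IsZero ((homotopy X m).obj obj)

end ThetaAlg

/-! ### Free simplicial resolutions -/

namespace GroupTheory

variable [CartesianMonoidalCategory Θ] (T : GroupTheory Θ)

/-- An algebra `F` is free if it is the free algebra on a graded set indexed by the sorts. -/
def IsFree (F : ThetaAlg Θ) : Prop :=
  ∃ (B : T.sorts → Type w) (b : ∀ s, B s → F.obj.obj (s : Θ)),
    ∀ (A : ThetaAlg Θ) (g : ∀ s, B s → A.obj.obj (s : Θ)),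
      ∃! φ : F ⟶ A, ∀ (s : T.sorts) (t : B s), φ.hom.app (s : Θ) (b s t) = g s t

variable {X : ThetaAlg Θ}

/-- Cofibrant objects of the resolution model category `s(Θ-Alg/X)`: retracts of free simplicial
objects, where `V` is free if `V _⦋k⦌ = L_k V ⨿ F_k` for free algebras `F_k`, with `L_k V` the
latching objects, that is, if it has a splitting with free algebras `F_k` over `X`. -/
def IsCofibrant (V : SimplicialObject (Over X)) : Prop :=
  ∃ (V' : SimplicialObject (Over X)) (s : SimplicialObject.Splitting V'),
    (∀ k, T.IsFree (s.N k).left) ∧ Nonempty (Retract V V')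

/-- For a sort `s`, the simplicial set `V(s)` underlying the simplicial group that a simplicial
algebra `V` over `X` has in degree `s`. -/
abbrev level (s : T.sorts) : SimplicialObject (Over X) ⥤ SSet.{w} :=
  (SimplicialObject.whiskering _ _).obj (Over.forget X ⋙ ThetaAlg.ev (s : Θ))

/-- `x` is the identity element of the group `A(s)`: it is in the image of the (one-point) set
`A(1)` under the identity operation `1 ⟶ s`. -/
def IsOne (A : ThetaAlg Θ) (s : T.sorts) (x : A.obj.obj (s : Θ)) : Prop :=
  ∃ u : A.obj.obj (MonoidalCategoryStruct.tensorUnit Θ), A.obj.map (T.grp s).one u = x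

/-- An `m`-simplex of `V(s)` represents an element of `π_m(V(s))`, at the identity element, if its
boundary is trivial. -/
def IsSpherical (V : SimplicialObject (Over X)) (s : T.sorts) {m : ℕ}
    (x : ((T.level s).obj V) _⦋m⦌) : Prop :=
  ∀ (l : ℕ) (φ : ⦋l⦌ ⟶ ⦋m⦌), l < m →
    T.IsOne (V _⦋l⦌).left s (((T.level s).obj V).map φ.op x)

/-- Two spherical `m`-simplices of `V(s)` represent the same element of `π_m(V(s))` if there is an
`(m + 1)`-simplex whose faces are these two and identity elements. -/
def IsHomotopic (V : SimplicialObject (Over X)) (s : T.sorts) {m : ℕ}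
    (x y : ((T.level s).obj V) _⦋m⦌) : Prop :=
  ∃ z : ((T.level s).obj V) _⦋m + 1⦌,
    ((T.level s).obj V).δ 0 z = x ∧ ((T.level s).obj V).δ 1 z = y ∧
      ∀ i : Fin (m + 2), 1 < i → T.IsOne (V _⦋m⦌).left s (((T.level s).obj V).δ i z)

/-- Weak equivalences of `s(Θ-Alg/X)`: maps that induce bijections on the homotopy groups
`π_m(V(s))` of the underlying simplicial groups, for all sorts `s` and all `m ≥ 0`. -/
def IsWeakEquivalence {V Y : SimplicialObject (Over X)} (f : V ⟶ Y) : Prop :=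
  ∀ (s : T.sorts) (m : ℕ),
    (∀ y : ((T.level s).obj Y) _⦋m⦌, T.IsSpherical Y s y →
      ∃ x : ((T.level s).obj V) _⦋m⦌, T.IsSpherical V s x ∧
        T.IsHomotopic Y s (((T.level s).map f).app _ x) y) ∧
    (∀ x x' : ((T.level s).obj V) _⦋m⦌, T.IsSpherical V s x → T.IsSpherical V s x' →
      T.IsHomotopic Y s (((T.level s).map f).app _ x) (((T.level s).map f).app _ x') →
        T.IsHomotopic V s x x')

/-- A free simplicial resolution (cofibrant replacement) of a simplicial algebra `Y` over `X`. An
algebra over `X` is regarded as a constant simplicial object. -/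
structure Resolution (Y : SimplicialObject (Over X)) where
  V : SimplicialObject (Over X)
  isCofibrant : T.IsCofibrant V
  map : V ⟶ Y
  isWeakEquivalence : T.IsWeakEquivalence map

end GroupTheory
end Theories
end

/-! Everything is linearised over the category of elements of `X`. Send an algebra `Y` over `X` to
the free abelian groups on its fibres (`freeFibres`), and an abelian group object `G` to its own
fibres (`fibres`). A map `Y ⟶ G` over `X` is the same as a morphism `freeFibres Y ⟶ fibres G`
(`homToFibres`). Let `P` and `Q` be the alternating face map complexes of `freeFibres V` and `fibres
E`. Then `Hom(V, G)` is the cochain complex `Hom(P, fibres G)`, while `π₀ map(V, E)` is the group of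
homotopy classes of chain maps `P ⟶ Q`: every chain map is homotopic to one coming from a simplicial
map (`exists_homotopic_map`), and a vertex lies in the component of zero iff its chain map is null
homotopic (`component_eq_zero_iff`).

The homology of `Q` is concentrated in degree `n`, where it is `fibres G`. If the terms of `P` were
projective, obstruction theory would give `[P, Q] ≅ Hⁿ(Hom(P, Hₙ Q))`. Only lifts against the
chains, cycles, boundaries and homology of `Q` are needed, and these functors all turn coproducts of
representables into products. A morphism from `freeFibres Y`, with `Y` such a coproduct, is
therefore given by freely chosen values on generators, and retracts inherit the lifting property
(`liftsAgainst`). Cofibrancy makes each `V _⦋k⦌` a retract of such a coproduct.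

The isomorphism is built as the graph of a relation between classes (`Corresponds`), which is
visibly additive and preserved by maps of resolutions and coefficients. Naturality then needs no
computation with choices.

For existence, abelian group objects over `X` form an additive category, so `Γ₀` applies to a
complex concentrated in degree `n`. As `fibres` is additive, it preserves the homotopy equivalence
between a complex and the chains on its `Γ₀`, and this yields the homotopy groups (`homologyΓ₀Iso`).
-/

noncomputable section

/-! ### Obstruction theory for chain maps into a complex with one homology group -/

section ChainMaps

/-- Dependent choice with an invariant `S`. It builds chain maps and homotopies one degree at a
time, with `S` ensuring that the next extension problem is solvable. -/
lemma exists_dependent_sequence {α : ℕ → Type*} (S : ∀ p, α p → Prop)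
    (R : ∀ p, α p → α (p + 1) → Prop) (a₀ : α 0) (h₀ : S 0 a₀)
    (step : ∀ p a, S p a → ∃ b, S (p + 1) b ∧ R p a b) :
    ∃ h : ∀ p, α p, h 0 = a₀ ∧ ∀ p, S p (h p) ∧ R p (h p) (h (p + 1)) := by
  choose b hb hR using step
  let s : ∀ p, {a : α p // S p a} :=
    fun p => Nat.rec ⟨a₀, h₀⟩ (fun p x => ⟨b p x.1 x.2, hb p x.1 x.2⟩) p
  exact ⟨fun p => (s p).1, rfl, fun p => ⟨(s p).2, hR p (s p).1 (s p).2⟩⟩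

variable {A : Type u} [Category.{v} A] [Abelian A] {P Q P' Q' : ChainComplex A ℕ}

/-- The null homotopic chain map with components `dh + hd`. -/
def nullHomotopicChainMap (h : ∀ p, P.X p ⟶ Q.X (p + 1)) : P ⟶ Q :=
  Homotopy.nullHomotopicMap' (fun i _ hij => h i ≫ eqToHom (congrArg Q.X hij))

lemma nullHomotopicChainMap_zero (h : ∀ p, P.X p ⟶ Q.X (p + 1)) :
    (nullHomotopicChainMap h).f 0 = h 0 ≫ Q.d 1 0 := by
  rw [nullHomotopicChainMap, Homotopy.nullHomotopicMap'_f_of_not_rel_left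
    (k₁ := 1) (k₀ := 0) rfl (by simp)]
  simp

lemma nullHomotopicChainMap_succ (h : ∀ p, P.X p ⟶ Q.X (p + 1)) (p : ℕ) :
    (nullHomotopicChainMap h).f (p + 1) =
      P.d (p + 1) p ≫ h p + h (p + 1) ≫ Q.d (p + 2) (p + 1) := by
  rw [nullHomotopicChainMap, Homotopy.nullHomotopicMap'_f
    (k₂ := p + 2) (k₁ := p + 1) (k₀ := p) rfl rfl]
  simp

lemma comp_nullHomotopicChainMap_comp (a : P' ⟶ P) (h : ∀ p, P.X p ⟶ Q.X (p + 1)) (e : Q ⟶ Q') :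
    a ≫ nullHomotopicChainMap h ≫ e =
      nullHomotopicChainMap (fun p => a.f p ≫ h p ≫ e.f (p + 1)) := by
  ext p
  cases p with
  | zero => simp [nullHomotopicChainMap_zero]
  | succ p => simp [nullHomotopicChainMap_succ]

lemma nullHomotopicChainMap_homotopic (h : ∀ p, P.X p ⟶ Q.X (p + 1)) :
    Nonempty (Homotopy (nullHomotopicChainMap h) 0) :=
  ⟨Homotopy.nullHomotopy' _⟩

lemma homotopic_zero_iff (φ : P ⟶ Q) : Nonempty (Homotopy φ 0) ↔
    ∃ h : ∀ p, P.X p ⟶ Q.X (p + 1), φ = nullHomotopicChainMap h := by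
  constructor
  · rintro ⟨H⟩
    refine ⟨fun p => H.hom p (p + 1), ?_⟩
    ext p
    cases p with
    | zero =>
      rw [H.comm 0, prevD_eq (j' := 1) (w := by simp), dNext_eq_zero _ _ (by simp),
        nullHomotopicChainMap_zero]
      simp
    | succ p =>
      rw [H.comm (p + 1), prevD_eq (j' := p + 2) (w := by simp),
        dNext_eq (i' := p) (w := by simp), nullHomotopicChainMap_succ]
      simp
  · rintro ⟨h, rfl⟩
    exact nullHomotopicChainMap_homotopic h

/-- `P` lifts against `Q`, as if its terms were projective, where `Q` has homology only in
degree `n`. -/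
structure LiftsAgainst (P Q : ChainComplex A ℕ) (n : ℕ) : Prop where
  exact : ∀ p q, q ≠ n → ∀ a : P.X p ⟶ Q.X q, (∀ j, a ≫ Q.d q j = 0) →
    ∃ b : P.X p ⟶ Q.X (q + 1), b ≫ Q.d (q + 1) q = a
  homology : ∀ p (c : P.X p ⟶ Q.homology n), ∃ z : P.X p ⟶ Q.cycles n, z ≫ Q.homologyπ n = c
  boundary : ∀ p (z : P.X p ⟶ Q.cycles n), z ≫ Q.homologyπ n = 0 →
    ∃ b : P.X p ⟶ Q.X (n + 1), b ≫ Q.toCycles (n + 1) n = z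

/-- A morphism `c : P_n ⟶ F`, where `γ : H_n Q ⟶ F`, represents the chain map `φ : P ⟶ Q` if `φ`
is homotopic to a chain map that vanishes in degrees less than `n` and whose component in degree `n`
induces `c`. -/
def Represents {n : ℕ} {F : A} (γ : Q.homology n ⟶ F) (c : P.X n ⟶ F) (φ : P ⟶ Q) : Prop :=
  ∃ ψ : P ⟶ Q, Nonempty (Homotopy φ ψ) ∧ (∀ i < n, ψ.f i = 0) ∧
    ∃ z : P.X n ⟶ Q.cycles n, z ≫ Q.iCycles n = ψ.f n ∧ z ≫ Q.homologyπ n ≫ γ = c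

namespace Represents

variable {n : ℕ} {F F' : A} {γ : Q.homology n ⟶ F} {γ' : Q'.homology n ⟶ F'}
  {c c' : P.X n ⟶ F} {φ φ' : P ⟶ Q}

lemma of_homotopy (h : Represents γ c φ) (H : Homotopy φ' φ) : Represents γ c φ' := by
  obtain ⟨ψ, ⟨H'⟩, h⟩ := h
  exact ⟨ψ, ⟨H.trans H'⟩, h⟩

lemma add (h : Represents γ c φ) (h' : Represents γ c' φ') :
    Represents γ (c + c') (φ + φ') := by
  obtain ⟨ψ, ⟨H⟩, hψ, z, hz, hc⟩ := h
  obtain ⟨ψ', ⟨H'⟩, hψ', z', hz', hc'⟩ := h'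
  refine ⟨ψ + ψ', ⟨H.add H'⟩, fun i hi => ?_, z + z', ?_, ?_⟩
  · simp [hψ i hi, hψ' i hi]
  · simp [hz, hz']
  · simp [hc, hc']

lemma neg (h : Represents γ c φ) : Represents γ (-c) (-φ) := by
  obtain ⟨ψ, ⟨H⟩, hψ, z, hz, hc⟩ := h
  refine ⟨-ψ, ⟨?_⟩, fun i hi => ?_, -z, ?_, ?_⟩
  · exact Homotopy.equivSubZero.symm
      ((Homotopy.ofEq (by abel)).trans (Homotopy.equivSubZero H.symm))
  · simp [hψ i hi]
  · simp [hz]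
  · simp [hc]

lemma sub (h : Represents γ c φ) (h' : Represents γ c' φ') :
    Represents γ (c - c') (φ - φ') := by
  rw [sub_eq_add_neg, sub_eq_add_neg]
  exact h.add h'.neg

lemma comp (h : Represents γ c φ) (a : P' ⟶ P) (e : Q ⟶ Q') (g : F ⟶ F')
    (hg : HomologicalComplex.homologyMap e n ≫ γ' = γ ≫ g) :
    Represents γ' (a.f n ≫ c ≫ g) (a ≫ φ ≫ e) := by
  obtain ⟨ψ, ⟨H⟩, hψ, z, hz, hc⟩ := h
  refine ⟨a ≫ ψ ≫ e, ⟨(H.compRight e).compLeft a⟩, fun i hi => ?_,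
    a.f n ≫ z ≫ HomologicalComplex.cyclesMap e n, ?_, ?_⟩
  · simp [hψ i hi]
  · simp [reassoc_of% hz]
  · simp [← hc, ← hg]

/-- As `ψ` is a chain map, `d ≫ z` factors through the boundaries of `Q` and dies in homology. -/
lemma d_comp (h : Represents γ c φ) : P.d (n + 1) n ≫ c = 0 := by
  obtain ⟨ψ, -, hψ, z, hz, hc⟩ := h
  have : P.d (n + 1) n ≫ z = ψ.f (n + 1) ≫ Q.toCycles (n + 1) n := by
    rw [← cancel_mono (Q.iCycles n)]
    simp [hz]
  rw [← hc, reassoc_of% this]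
  simp

end Represents

variable {m : ℕ} {F : A} {γ : Q.homology (m + 1) ⟶ F}

/-- Take zero below degree `m + 1` and a cycle lifting `c` in that degree. The cocycle condition
allows the step to degree `m + 2`, and exactness of `Q` all later ones. -/
lemma exists_represented [IsIso γ] (hPQ : LiftsAgainst P Q (m + 1)) (c : P.X (m + 1) ⟶ F)
    (hc : P.d (m + 2) (m + 1) ≫ c = 0) : ∃ φ : P ⟶ Q, Represents γ c φ := by
  obtain ⟨z, hz⟩ := hPQ.homology _ (c ≫ inv γ)
  obtain ⟨b, hb⟩ := hPQ.boundary _ (P.d (m + 2) (m + 1) ≫ z) (by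
    rw [Category.assoc, hz, reassoc_of% hc, zero_comp])
  obtain ⟨h, -, hh⟩ := exists_dependent_sequence (α := fun p => P.X p ⟶ Q.X p)
    -- The last clause says that `d ≫ a` lands in cycles, which is what the next lift requires.
    (fun p a => (p < m + 1 → a = 0) ∧ (∀ h : m + 1 = p, a = h ▸ (z ≫ Q.iCycles (m + 1))) ∧
      ∀ j, P.d (p + 1) p ≫ a ≫ Q.d p j = 0)
    (fun p a b => P.d (p + 1) p ≫ a = b ≫ Q.d (p + 1) p) 0 (by simp) (by
      rintro p a ⟨h₁, h₂, h₃⟩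
      suffices ∃ b : P.X (p + 1) ⟶ Q.X (p + 1), (p + 1 < m + 1 → b = 0) ∧
          (∀ h : m + 1 = p + 1, b = h ▸ (z ≫ Q.iCycles (m + 1))) ∧
          P.d (p + 1) p ≫ a = b ≫ Q.d (p + 1) p by
        obtain ⟨b, h₁, h₂, h₃⟩ := this
        refine ⟨b, ⟨h₁, h₂, fun j => ?_⟩, h₃⟩
        by_cases hj : j = p
        · subst hj
          rw [← h₃]
          simp
        · rw [Q.shape _ _ (by simpa using hj)]
          simp
      rcases lt_trichotomy p m with hp | rfl | hp
      · exact ⟨0, by simp, by omega, by simp [h₁ (by omega)]⟩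
      · exact ⟨z ≫ Q.iCycles _, by simp, by simp, by simp [h₁ (by omega)]⟩
      · by_cases hp' : m + 1 = p
        · subst hp'
          refine ⟨b, by omega, by omega, ?_⟩
          rw [h₂ rfl, ← Q.toCycles_i (m + 1 + 1) (m + 1), ← Category.assoc b]
          exact (by simp : _ = (P.d (m + 2) (m + 1) ≫ z) ≫ Q.iCycles (m + 1)).trans
            (hb =≫ Q.iCycles (m + 1)).symm
        · obtain ⟨b, hb⟩ := hPQ.exact _ p (Ne.symm hp') (P.d (p + 1) p ≫ a)
            (fun j => by rw [Category.assoc, h₃])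
          exact ⟨b, by omega, by omega, hb.symm⟩)
  let ψ : P ⟶ Q := { f := h, comm' := by rintro _ j rfl; exact (hh j).2.symm }
  refine ⟨ψ, ψ, ⟨Homotopy.refl _⟩, fun i hi => (hh i).1.1 hi, z, ((hh _).1.2.1 rfl).symm, ?_⟩
  rw [reassoc_of% hz]
  simp

/-- Below degree `m + 1` the complex `Q` is exact, so `φ` can be contracted there degree by degree.
The corrected map vanishes in degree `m`, hence is a cycle in degree `m + 1`. -/
lemma exists_represents (hPQ : LiftsAgainst P Q (m + 1)) (φ : P ⟶ Q) :
    ∃ c : P.X (m + 1) ⟶ F, Represents γ c φ := by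
  obtain ⟨a₀, ha₀⟩ := hPQ.exact 0 0 (by omega) (φ.f 0) (fun j => by simp)
  obtain ⟨h, h₀, hh⟩ := exists_dependent_sequence (α := fun p => P.X p ⟶ Q.X (p + 1))
    (fun p a => p < m + 1 → P.d (p + 1) p ≫ (φ.f p - a ≫ Q.d (p + 1) p) = 0)
    (fun p a b => p + 1 < m + 1 →
      φ.f (p + 1) = P.d (p + 1) p ≫ a + b ≫ Q.d (p + 2) (p + 1)) a₀ (by simp [ha₀]) (by
      intro p a ha
      by_cases hp : p + 1 < m + 1
      · obtain ⟨b, hb⟩ := hPQ.exact (p + 1) (p + 1) (by omega) (φ.f (p + 1) - P.d (p + 1) p ≫ a)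
          (fun j => by
            by_cases hj : j = p
            · subst hj
              have := ha (by omega)
              rw [Preadditive.comp_sub] at this
              simpa using this
            · rw [Q.shape _ _ (by simp; omega), comp_zero])
        refine ⟨b, fun _ => ?_, fun _ => ?_⟩
        · simp [hb]
        · simp [hb]
      -- From degree `m + 1` on, the homotopy may be anything; zero is chosen.
      · exact ⟨0, by omega, by omega⟩)
  let ψ := φ - nullHomotopicChainMap h
  have hψ : ∀ i < m + 1, ψ.f i = 0 := by
    intro i hi
    cases i with
    | zero => simp [ψ, nullHomotopicChainMap_zero, h₀, ha₀]
    | succ i => simp [ψ, nullHomotopicChainMap_succ, (hh i).2 hi]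
  refine ⟨_, ψ, ?_, hψ, Q.liftCycles (ψ.f (m + 1)) m (by simp) (by simp [hψ m]), by simp, rfl⟩
  obtain ⟨H⟩ := nullHomotopicChainMap_homotopic h
  exact ⟨Homotopy.equivSubZero.symm ((Homotopy.ofEq (by simp [ψ])).trans H)⟩

/-- The cycle `z` has zero class, so it is the boundary of some `b`. The null homotopy of `ψ` is
zero below degree `m + 1`, starts with `b` there, and continues by exactness of `Q` above. -/
lemma Represents.homotopic_zero [Mono γ] (hPQ : LiftsAgainst P Q (m + 1)) {φ : P ⟶ Q}
    (hφ : Represents γ 0 φ) : Nonempty (Homotopy φ 0) := by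
  obtain ⟨ψ, ⟨H⟩, hψ, z, hz, hc⟩ := hφ
  obtain ⟨b, hb⟩ := hPQ.boundary _ z (by
    rwa [← cancel_mono γ, Category.assoc, zero_comp])
  have hb : b ≫ Q.d (m + 2) (m + 1) = ψ.f (m + 1) := by
    rw [← hz, ← hb, Category.assoc, Q.toCycles_i]
  suffices Nonempty (Homotopy ψ 0) from ⟨H.trans this.some⟩
  obtain ⟨h, h₀, hh⟩ := exists_dependent_sequence (α := fun p => P.X p ⟶ Q.X (p + 1))
    (fun p a => (p < m + 1 → a = 0) ∧ (∀ h : m + 1 = p, a = h ▸ b) ∧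
      P.d (p + 1) p ≫ (ψ.f p - a ≫ Q.d (p + 1) p) = 0)
    (fun p a b => ψ.f (p + 1) = P.d (p + 1) p ≫ a + b ≫ Q.d (p + 2) (p + 1)) 0
    (by simp [hψ 0]) (by
      rintro p a ⟨h₁, h₂, h₃⟩
      suffices ∃ b' : P.X (p + 1) ⟶ Q.X (p + 1 + 1), (p + 1 < m + 1 → b' = 0) ∧
          (∀ h : m + 1 = p + 1, b' = h ▸ b) ∧
          ψ.f (p + 1) = P.d (p + 1) p ≫ a + b' ≫ Q.d (p + 2) (p + 1) by
        obtain ⟨b, h₁, h₂, h₃⟩ := this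
        exact ⟨b, ⟨h₁, h₂, by simp [h₃]⟩, h₃⟩
      rcases lt_trichotomy p m with hp | rfl | hp
      · exact ⟨0, by simp, by omega, by simp [h₁ (by omega), hψ (p + 1) (by omega)]⟩
      · exact ⟨b, by simp, by simp, by simp [h₁ (by omega), hb]⟩
      · obtain ⟨b, hb⟩ := hPQ.exact (p + 1) (p + 1) (by omega) (ψ.f (p + 1) - P.d (p + 1) p ≫ a)
          (fun j => by
            by_cases hj : j = p
            · subst hj
              rw [Preadditive.comp_sub] at h₃
              simpa using h₃
            · rw [Q.shape _ _ (by simp; omega), comp_zero])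
        exact ⟨b, by omega, by omega, by simp [hb]⟩)
  refine (homotopic_zero_iff ψ).2 ⟨h, ?_⟩
  ext p
  cases p with
  | zero => simp [nullHomotopicChainMap_zero, h₀, hψ 0]
  | succ p => rw [nullHomotopicChainMap_succ, (hh p).2]

/-- Lift `b` to a cycle and use it as a homotopy concentrated in degree `m`. Because it takes values
in cycles, the resulting null homotopic map lives in degree `m + 1` only, where it induces the
coboundary of `b`. -/
lemma represents_coboundary [IsIso γ] (hPQ : LiftsAgainst P Q (m + 1)) (b : P.X m ⟶ F) :
    Represents γ (P.d (m + 1) m ≫ b) (0 : P ⟶ Q) := by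
  obtain ⟨y, hy⟩ := hPQ.homology _ (b ≫ inv γ)
  let h : ∀ p, P.X p ⟶ Q.X (p + 1) := Pi.single m (y ≫ Q.iCycles (m + 1))
  have hm : h m = y ≫ Q.iCycles (m + 1) := Pi.single_eq_same _ _
  have hne (p : ℕ) (hp : p ≠ m) : h p = 0 := Pi.single_eq_of_ne hp _
  obtain ⟨H⟩ := nullHomotopicChainMap_homotopic h
  refine ⟨nullHomotopicChainMap h, ⟨H.symm⟩, fun i hi => ?_, P.d (m + 1) m ≫ y, ?_, ?_⟩
  · have hi' : h i ≫ Q.d (i + 1) i = 0 := by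
      by_cases him : i = m
      · subst him
        simp [hm]
      · simp [hne i him]
    cases i with
    | zero => rw [nullHomotopicChainMap_zero, hi']
    | succ i => rw [nullHomotopicChainMap_succ, hi', hne i (by omega), comp_zero, zero_add]
  · rw [nullHomotopicChainMap_succ, hm, hne (m + 1) (by omega)]
    simp
  · rw [Category.assoc, reassoc_of% hy]
    simp

lemma Represents.exists_coboundary (hPQ : LiftsAgainst P Q (m + 1)) {φ : P ⟶ Q}
    {c : P.X (m + 1) ⟶ F} (hφ : Represents γ c φ) (H : Homotopy φ 0) :
    ∃ b : P.X m ⟶ F, P.d (m + 1) m ≫ b = c := by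
  obtain ⟨ψ, ⟨H'⟩, hψ, z, hz, hc⟩ := hφ
  obtain ⟨h, hh⟩ := (homotopic_zero_iff ψ).1 ⟨H'.symm.trans H⟩
  -- The component `h m` need not be cycle-valued, so it has no class in `F`. Since `ψ` vanishes up
  -- to degree `m`, a secondary homotopy corrects it without changing `d ≫ h m`.
  have key : ∀ p ≤ m, ∃ y : P.X p ⟶ Q.X (p + 1), y ≫ Q.d (p + 1) p = 0 ∧
      P.d (p + 1) p ≫ y = P.d (p + 1) p ≫ h p := by
    intro p
    induction p with
    | zero =>
      intro _
      refine ⟨h 0, ?_, rfl⟩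
      rw [← nullHomotopicChainMap_zero, ← hh, hψ 0 (by omega)]
    | succ p ih =>
      intro hp
      obtain ⟨y, hy, hy'⟩ := ih (by omega)
      obtain ⟨k, hk⟩ := hPQ.exact p (p + 1) (by omega) y (fun j => by
        by_cases hj : j = p
        · subst hj
          exact hy
        · rw [Q.shape _ _ (by simp; omega), comp_zero])
      refine ⟨h (p + 1) + P.d (p + 1) p ≫ k, ?_, by simp⟩
      have h₂ := nullHomotopicChainMap_succ h p
      rw [← hh, hψ _ (by omega)] at h₂
      rw [Preadditive.add_comp, Category.assoc, hk, hy', h₂]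
      exact add_comm _ _
  obtain ⟨y, hy, hy'⟩ := key m le_rfl
  let y' := Q.liftCycles y m (by simp) hy
  refine ⟨y' ≫ Q.homologyπ _ ≫ γ, ?_⟩
  have : z = P.d (m + 1) m ≫ y' + h (m + 1) ≫ Q.toCycles (m + 2) (m + 1) := by
    rw [← cancel_mono (Q.iCycles (m + 1)), hz, hh, nullHomotopicChainMap_succ, ← hy']
    simp [y']
  rw [← hc, this]
  simp

/-- If `c` is a coboundary, it represents both `φ` and zero; by subtraction, zero represents `φ`. -/
lemma Represents.coboundary_iff [IsIso γ] (hPQ : LiftsAgainst P Q (m + 1)) {φ : P ⟶ Q}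
    {c : P.X (m + 1) ⟶ F} (hφ : Represents γ c φ) :
    (∃ b : P.X m ⟶ F, P.d (m + 1) m ≫ b = c) ↔ Nonempty (Homotopy φ 0) := by
  refine ⟨?_, fun ⟨H⟩ => hφ.exists_coboundary hPQ H⟩
  rintro ⟨b, rfl⟩
  have := hφ.sub (represents_coboundary hPQ b)
  rw [sub_self, sub_zero] at this
  exact this.homotopic_zero hPQ

end ChainMaps

/-! ### The Dold–Kan correspondence up to homotopy -/

section DoldKan

open AlgebraicTopology AlgebraicTopology.DoldKan

variable {A : Type u} [Category.{v} A] [Preadditive A] {X Y : SimplicialObject A}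

section

variable [HasFiniteCoproducts A]

/-- `N₁` is the embedding into the Karoubi envelope followed by the Dold–Kan equivalence `N₂`. -/
instance : (N₁ (C := A)).Full := by
  have : (N₂ (C := A)).IsEquivalence := 
    inferInstanceAs (Preadditive.DoldKan.equivalence (C := A)).functor.IsEquivalence
  exact Functor.Full.of_iso toKaroubiCompN₂IsoN₁

instance : (N₁ (C := A)).Faithful := by
  have : (N₂ (C := A)).IsEquivalence := 
    inferInstanceAs (Preadditive.DoldKan.equivalence (C := A)).functor.IsEquivalence
  exact Functor.Faithful.of_iso toKaroubiCompN₂IsoN₁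

lemma exists_PInfty_comp_map_eq
    (g : (alternatingFaceMapComplex A).obj X ⟶ (alternatingFaceMapComplex A).obj Y) :
    ∃ f : X ⟶ Y, PInfty ≫ (alternatingFaceMapComplex A).map f = PInfty ≫ g ≫ PInfty := by
  let g' : N₁.obj X ⟶ N₁.obj Y := ⟨PInfty ≫ g ≫ PInfty, by simp⟩
  obtain ⟨f, hf⟩ := N₁.map_surjective g'
  exact ⟨f, congrArg Idempotents.Karoubi.Hom.f hf⟩

lemma eq_of_PInfty_comp_map_eq {f f' : X ⟶ Y}
    (h : PInfty ≫ (alternatingFaceMapComplex A).map f =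
      PInfty ≫ (alternatingFaceMapComplex A).map f') : f = f' := by
  apply N₁.map_injective
  ext1
  exact h

/-- Compressing `g` by `PInfty` on both sides gives a morphism in the image of `N₁`, and `PInfty` is
homotopic to the identity. -/
lemma exists_homotopic_map
    (g : (alternatingFaceMapComplex A).obj X ⟶ (alternatingFaceMapComplex A).obj Y) :
    ∃ f : X ⟶ Y, Nonempty (Homotopy ((alternatingFaceMapComplex A).map f) g) := by
  obtain ⟨f, hf⟩ := exists_PInfty_comp_map_eq g
  have H₁ := (homotopyPInftyToId X).compRight ((alternatingFaceMapComplex A).map f)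
  have H₂ := ((homotopyPInftyToId Y).compLeft g).compLeft PInfty
  have H₃ := (homotopyPInftyToId X).compRight g
  rw [Category.id_comp] at H₁ H₃
  rw [Category.comp_id] at H₂
  exact ⟨f, ⟨H₁.symm.trans ((Homotopy.ofEq hf).trans (H₂.trans H₃))⟩⟩

end 

end DoldKan

/-! ### Décalage as a path object -/

namespace SimplexCategory

/-- The functor `[k] ↦ [0] ⋆ [k] = [k + 1]`. -/
def cone : SimplexCategory ⥤ SimplexCategory where
  obj k := ⦋k.len + 1⦌
  map {k l} θ := mkHom ⟨Fin.cases 0 (fun i => (θ.toOrderHom i).succ), by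
    intro i j hij
    induction i using Fin.cases with
    | zero => exact Fin.zero_le _
    | succ i =>
      induction j using Fin.cases with
      | zero => simp at hij
      | succ j => simpa using θ.toOrderHom.monotone (by simpa using hij)⟩
  map_id k := by
    ext i : 3
    induction i using Fin.cases <;> rfl
  map_comp f g := by
    ext i : 3
    induction i using Fin.cases <;> rfl

/-- The inclusion `[k] ⟶ [0] ⋆ [k]`. -/
def toCone : 𝟭 SimplexCategory ⟶ cone where
  app k := δ (n := k.len) 0

end SimplexCategory

namespace CategoryTheory.SimplicialObject

variable {C : Type u} [Category.{v} C]

/-- The décalage `[k] ↦ Y [k + 1]` of a simplicial object, forgetting the first face. -/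
def decalage (Y : SimplicialObject C) : SimplicialObject C := SimplexCategory.cone.op ⋙ Y

/-- The map from the décalage given by the first face. -/
def decalageFace (Y : SimplicialObject C) : decalage Y ⟶ Y :=
  Functor.whiskerRight (NatTrans.op SimplexCategory.toCone) Y

lemma decalage_δ (Y : SimplicialObject C) {k : ℕ} (i : Fin (k + 2)) :
    (decalage Y).δ i = Y.δ i.succ := by
  change Y.map (SimplexCategory.cone.map (SimplexCategory.δ i)).op =
    Y.map (SimplexCategory.δ i.succ).op
  congr 2
  ext j : 3
  induction j using Fin.cases with
  | zero => exact (Fin.succ_succAbove_zero i).symm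
  | succ j => exact (Fin.succ_succAbove_succ i j).symm

end CategoryTheory.SimplicialObject

section Decalage

open AlgebraicTopology AlgebraicTopology.DoldKan SimplicialObject

variable {A : Type u} [Category.{v} A] [Abelian A] {X Y : SimplicialObject A}

lemma higherFacesVanish_comp_d {Z : A} {k : ℕ} {a : Z ⟶ Y _⦋k + 1⦌}
    (ha : ∀ j : Fin (k + 1), a ≫ Y.δ j.succ = 0) :
    a ≫ ((alternatingFaceMapComplex A).obj Y).d (k + 1) k = a ≫ Y.δ 0 := by
  rw [alternatingFaceMapComplex_obj_d, AlternatingFaceMapComplex.objD, Fin.sum_univ_succ,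
    Preadditive.comp_add, Preadditive.comp_sum, Finset.sum_eq_zero]
  · simp
  · intro i _
    rw [Preadditive.comp_zsmul, ha, smul_zero]

lemma higherFacesVanish_comp_decalage_d {Z : A} {k : ℕ} {a : Z ⟶ (decalage Y) _⦋k + 1⦌}
    (ha : ∀ j : Fin (k + 1), (show Z ⟶ Y _⦋k + 2⦌ from a) ≫ Y.δ j.succ.succ = 0) :
    a ≫ ((alternatingFaceMapComplex A).obj (decalage Y)).d (k + 1) k =
      (show Z ⟶ Y _⦋k + 2⦌ from a) ≫ Y.δ 1 := by
  rw [higherFacesVanish_comp_d (fun j => by rw [decalage_δ]; exact ha j), decalage_δ]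
  rfl

/-- The décalage plays the role of paths, with end point the face `0` and starting point read off
from `δ 1` in degree zero. After normalising the homotopy to `h'`, the lift is `h' + d h' σ₀` on
chains. Its face `0` is `h' d + d h'`, the normalised part of `f`; its face `1` is `d h'`, making it
a chain map; the other faces vanish. -/
lemma exists_lift_decalage {f : X ⟶ Y}
    (hf : Nonempty (Homotopy ((alternatingFaceMapComplex A).map f) 0)) :
    ∃ f' : X ⟶ decalage Y, f' ≫ decalageFace Y = f ∧
      (show X _⦋0⦌ ⟶ Y _⦋1⦌ from f'.app (op ⦋0⦌)) ≫ Y.δ 1 = 0 := by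
  obtain ⟨h, hh⟩ := (homotopic_zero_iff _).1 hf
  -- The right-hand projector kills all faces of `h'` but the face `0`; the left-hand one makes `h'`
  -- invariant under `PInfty`, so that Dold–Kan faithfulness applies.
  let h' : ∀ p, X _⦋p⦌ ⟶ Y _⦋p + 1⦌ := fun p => PInfty.f p ≫ h p ≫ PInfty.f (p + 1)
  have hPf : PInfty ≫ (alternatingFaceMapComplex A).map f = nullHomotopicChainMap h' := by
    have := comp_nullHomotopicChainMap_comp PInfty h PInfty
    rw [← hh] at this
    rw [← this]
    have nat := (natTransPInfty A).naturality f
    dsimp only [natTransPInfty] at nat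
    rw [nat, PInfty_idem_assoc]
  have hP (p : ℕ) : PInfty.f p ≫ h' p = h' p := by simp [h']
  have hv (p : ℕ) (j : Fin (p + 1)) : h' p ≫ Y.δ j.succ = 0 := by
    have := HigherFacesVanish.of_P (X := Y) (p + 1) p j (by omega)
    simp only [h', Category.assoc, PInfty_f]
    rw [this, comp_zero, comp_zero]
  let dX : ∀ p, X _⦋p + 1⦌ ⟶ X _⦋p⦌ := fun p => ((alternatingFaceMapComplex A).obj X).d (p + 1) p
  let s : ∀ p, X _⦋p + 1⦌ ⟶ Y _⦋p + 2⦌ := fun p => dX p ≫ h' p ≫ Y.σ 0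
  have hs₀ (p : ℕ) : s p ≫ Y.δ 0 = dX p ≫ h' p := by
    have := Y.δ_comp_σ_self (i := (0 : Fin (p + 2)))
    simp only [s, Category.assoc]
    erw [this, Category.comp_id]
  have hs₁ (p : ℕ) : s p ≫ Y.δ 1 = dX p ≫ h' p := by
    have := Y.δ_comp_σ_succ (i := (0 : Fin (p + 2)))
    simp only [s, Category.assoc]
    erw [this, Category.comp_id]
  have hs₂ (p : ℕ) (j : Fin (p + 1)) : s p ≫ Y.δ j.succ.succ = 0 := by
    have := Y.δ_comp_σ_of_gt (i := j.succ) (j := (0 : Fin (p + 1))) (by simp)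
    simp only [s, Category.assoc]
    erw [this]
    rw [reassoc_of% (hv p j), zero_comp, comp_zero]
  -- Degree zero has no correction term, as there is no differential out of it.
  let g₀ : ∀ p, X _⦋p⦌ ⟶ (decalage Y) _⦋p⦌ := fun p => match p with
    | 0 => h' 0
    | p + 1 => (h' (p + 1) + s p : X _⦋p + 1⦌ ⟶ Y _⦋p + 2⦌)
  have hg₂ (p : ℕ) (j : Fin (p + 1)) :
      (h' (p + 1) + s p : X _⦋p + 1⦌ ⟶ Y _⦋p + 2⦌) ≫ Y.δ j.succ.succ = 0 := by
    rw [Preadditive.add_comp, hv, hs₂, add_zero]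
  have hdg (p : ℕ) : dX p ≫ g₀ p = dX p ≫ h' p := by
    cases p with
    | zero => rfl
    | succ p =>
      change dX (p + 1) ≫ (h' (p + 1) + s p : X _⦋p + 1⦌ ⟶ Y _⦋p + 2⦌) = _
      have : dX (p + 1) ≫ dX p = 0 :=
        ((alternatingFaceMapComplex A).obj X).d_comp_d (p + 2) (p + 1) p
      rw [Preadditive.comp_add, add_eq_left]
      exact (Category.assoc _ _ _).symm.trans ((this =≫ _).trans zero_comp)
  let g : (alternatingFaceMapComplex A).obj X ⟶ (alternatingFaceMapComplex A).obj (decalage Y) :=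
    { f := g₀
      comm' := by
        rintro _ p rfl
        refine (higherFacesVanish_comp_decalage_d (hg₂ p)).trans ?_
        refine Eq.trans ?_ (hdg p).symm
        have h₁ : h' (p + 1) ≫ Y.δ 1 = 0 := hv (p + 1) 0
        exact (Preadditive.add_comp _ _ _ _ _ _).trans (by rw [h₁, hs₁, zero_add]) }
  have hPd (p : ℕ) : PInfty.f (p + 1) ≫ dX p = dX p ≫ PInfty.f p := (PInfty (X := X)).comm _ _
  have hPg : PInfty ≫ g = g := by
    ext p
    cases p with
    | zero => exact hP 0
    | succ p =>
      refine (Preadditive.comp_add _ _ _ _ (h' (p + 1)) (s p)).trans ?_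
      rw [hP]
      congr 1
      simp only [s]
      rw [reassoc_of% (hPd p), reassoc_of% (hP p)]
  have hgP : g ≫ PInfty = g := by
    ext p
    cases p with
    | zero => exact Category.comp_id _
    | succ p =>
      have hv' : HigherFacesVanish (p + 1) (g₀ (p + 1)) := fun j _ => by
        rw [decalage_δ]
        exact hg₂ p j
      exact hv'.comp_P_eq_self
  obtain ⟨f', hf'⟩ := exists_PInfty_comp_map_eq g
  rw [hgP, hPg] at hf'
  refine ⟨f', eq_of_PInfty_comp_map_eq ?_, ?_⟩
  · rw [Functor.map_comp, reassoc_of% hf', hPf]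
    ext p
    cases p with
    | zero =>
      rw [nullHomotopicChainMap_zero]
      exact (higherFacesVanish_comp_d (hv 0)).symm
    | succ p =>
      rw [nullHomotopicChainMap_succ]
      refine (Preadditive.add_comp _ _ _ (h' (p + 1)) (s p) (Y.δ 0)).trans ?_
      rw [hs₀]
      exact (congrArg (fun x : X _⦋p + 1⦌ ⟶ Y _⦋p + 1⦌ => x + dX p ≫ h' p)
        (higherFacesVanish_comp_d (hv (p + 1))).symm).trans (add_comm _ _)
  · have h₀ : f'.app (op ⦋0⦌) = h' 0 := by
      have := HomologicalComplex.congr_hom hf' 0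
      exact (Category.id_comp _).symm.trans this
    rw [h₀]
    exact hv 0 0

end Decalage

/-! ### Algebras over `X` as functors on the category of elements -/

namespace ThetaAlg

variable {Θ : Type w} [SmallCategory Θ] (X : ThetaAlg Θ)

/-- The set-valued functor of fibres of an algebra over `X`. -/
def fibreSets : Over X ⥤ X.obj.Elements ⥤ Type w :=
  ((repOver X).rightOp ⋙ coyoneda).flip

/-- The free abelian groups on the fibres of an algebra over `X`. -/
def freeFibres : Over X ⥤ X.obj.Elements ⥤ AddCommGrpCat.{w} :=
  fibreSets X ⋙ (Functor.whiskeringRight _ _ _).obj AddCommGrpCat.free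

variable {X}

/-- The generator of the free abelian group associated with an element of a fibre. -/
def generator {Y : Over X} {e : X.obj.Elements} (y : (repOver X).obj (op e) ⟶ Y) :
    ((freeFibres X).obj Y).obj e := FreeAbelianGroup.of y

lemma freeFibres_map_generator {Y Z : Over X} (f : Y ⟶ Z) {e : X.obj.Elements}
    (y : (repOver X).obj (op e) ⟶ Y) :
    ((freeFibres X).map f).app e (generator y) = generator (y ≫ f) :=
  FreeAbelianGroup.map_of_apply _

lemma freeFibres_obj_map_generator {Y : Over X} {e e' : X.obj.Elements} (f : e ⟶ e')
    (y : (repOver X).obj (op e) ⟶ Y) :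
    ((freeFibres X).obj Y).map f (generator y) = generator ((repOver X).map f.op ≫ y) :=
  FreeAbelianGroup.map_of_apply _

lemma freeFibres_hom_ext {Y : Over X} {M : X.obj.Elements ⥤ AddCommGrpCat.{w}}
    {φ φ' : (freeFibres X).obj Y ⟶ M}
    (h : ∀ (e : X.obj.Elements) (y : (repOver X).obj (op e) ⟶ Y),
      φ.app e (generator y) = φ'.app e (generator y)) : φ = φ' := by
  ext e : 2
  apply AddCommGrpCat.hom_ext
  exact FreeAbelianGroup.lift_ext _ _ (h e)

/-- Morphisms from the free abelian groups on the fibres of `Y` are given by natural maps defined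
on the fibres of `Y`. -/
def freeFibresDesc {Y : Over X} {M : X.obj.Elements ⥤ AddCommGrpCat.{w}}
    (τ : ∀ e : X.obj.Elements, ((repOver X).obj (op e) ⟶ Y) → M.obj e)
    (hτ : ∀ {e e' : X.obj.Elements} (f : e ⟶ e') (y : (repOver X).obj (op e) ⟶ Y),
      τ e' ((repOver X).map f.op ≫ y) = M.map f (τ e y)) :
    (freeFibres X).obj Y ⟶ M where
  app e := AddCommGrpCat.ofHom (FreeAbelianGroup.lift (τ e))
  naturality e e' f := by
    apply AddCommGrpCat.hom_ext
    refine FreeAbelianGroup.lift_ext _ _ fun y => ?_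
    have h₁ : FreeAbelianGroup.lift (τ e') (FreeAbelianGroup.of ((repOver X).map f.op ≫ y)) =
        M.map f (FreeAbelianGroup.lift (τ e) (FreeAbelianGroup.of y)) :=
      (FreeAbelianGroup.lift_apply_of _ _).trans
        ((hτ f y).trans (congrArg (M.map f) (FreeAbelianGroup.lift_apply_of _ _).symm))
    exact (congrArg (FreeAbelianGroup.lift (τ e')) (freeFibres_obj_map_generator f y)).trans h₁

lemma freeFibresDesc_generator {Y : Over X} {M : X.obj.Elements ⥤ AddCommGrpCat.{w}}
    (τ : ∀ e : X.obj.Elements, ((repOver X).obj (op e) ⟶ Y) → M.obj e)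
    (hτ : ∀ {e e' : X.obj.Elements} (f : e ⟶ e') (y : (repOver X).obj (op e) ⟶ Y),
      τ e' ((repOver X).map f.op ≫ y) = M.map f (τ e y))
    {e : X.obj.Elements} (y : (repOver X).obj (op e) ⟶ Y) :
    (freeFibresDesc τ hτ).app e (generator y) = τ e y :=
  FreeAbelianGroup.lift_apply_of _ _

/-- The element of `Y(θ)` corresponding to a map to `Y` from a representable algebra over `X`. -/
def element {Y : Over X} {e : X.obj.Elements} (y : (repOver X).obj (op e) ⟶ Y) :
    Y.left.obj.obj e.1 := y.left.hom.app e.1 (𝟙 e.1)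

lemma element_map_comp {Y : Over X} {e e' : X.obj.Elements} (f : e ⟶ e')
    (y : (repOver X).obj (op e) ⟶ Y) :
    element ((repOver X).map f.op ≫ y) = Y.left.obj.map f.1 (element y) := by
  have := ConcreteCategory.congr_hom (y.left.hom.naturality f.1) (𝟙 e.1)
  refine Eq.trans ?_ this
  change y.left.hom.app e'.1 (f.1 ≫ 𝟙 _) = y.left.hom.app e'.1 (𝟙 _ ≫ f.1)
  simp

lemma element_over {Y : Over X} {e : X.obj.Elements} (y : (repOver X).obj (op e) ⟶ Y) :
    Y.hom.hom.app e.1 (element y) = e.2 := by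
  have h : y.left ≫ Y.hom = _ := Over.w y
  have := ConcreteCategory.congr_hom 
    (congrArg (fun f : (rep e.1 ⟶ X) => f.hom.app e.1) h) (𝟙 e.1)
  refine Eq.trans this ?_
  exact ConcreteCategory.congr_hom (X.obj.map_id e.1) e.2

lemma element_injective {Y : Over X} {e : X.obj.Elements} {y y' : (repOver X).obj (op e) ⟶ Y}
    (h : element y = element y') : y = y' := by
  ext1
  apply ObjectProperty.hom_ext
  exact coyonedaEquiv.injective h

/-- The map to `Y` from a representable algebra over `X` corresponding to an element. -/
def ofElement {Y : Over X} {e : X.obj.Elements} (y : Y.left.obj.obj e.1)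
    (hy : Y.hom.hom.app e.1 y = e.2) : (repOver X).obj (op e) ⟶ Y :=
  Over.homMk (ObjectProperty.homMk (coyonedaEquiv.symm y)) (by
    apply ObjectProperty.hom_ext
    apply coyonedaEquiv.injective
    refine Eq.trans (b := e.2) ?_ (coyonedaEquiv.apply_symm_apply e.2).symm
    refine Eq.trans ?_ hy
    exact congrArg (Y.hom.hom.app e.1) (coyonedaEquiv.apply_symm_apply y))

lemma element_ofElement {Y : Over X} {e : X.obj.Elements} (y : Y.left.obj.obj e.1)
    (hy : Y.hom.hom.app e.1 y = e.2) : element (ofElement y hy) = y :=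
  coyonedaEquiv.apply_symm_apply y

lemma over_hom_ext {Y Z : Over X} {a b : Y ⟶ Z}
    (h : ∀ (e : X.obj.Elements) (y : (repOver X).obj (op e) ⟶ Y), y ≫ a = y ≫ b) : a = b := by
  ext θ y
  have h₁ := congrArg element (h ⟨θ, Y.hom.hom.app θ y⟩ (ofElement y rfl))
  have h₂ := element_ofElement (e := ⟨θ, Y.hom.hom.app θ y⟩) y rfl
  exact (congrArg (a.left.hom.app θ) h₂).symm.trans (h₁.trans (congrArg (b.left.hom.app θ) h₂))

/-- Each element of `Y(θ)` lies in exactly one fibre, so maps on fibres glue to a map on `Y(θ)`.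
Compatibility with morphisms of elements is naturality in `θ`. -/
lemma exists_over_hom {Y Z : Over X}
    (τ : ∀ e : X.obj.Elements, ((repOver X).obj (op e) ⟶ Y) → ((repOver X).obj (op e) ⟶ Z))
    (hτ : ∀ {e e' : X.obj.Elements} (f : e ⟶ e') (y : (repOver X).obj (op e) ⟶ Y),
      τ e' ((repOver X).map f.op ≫ y) = (repOver X).map f.op ≫ τ e y) :
    ∃ a : Y ⟶ Z, ∀ (e : X.obj.Elements) (y : (repOver X).obj (op e) ⟶ Y), y ≫ a = τ e y := by
  let t (θ : Θ) (y : Y.left.obj.obj θ) : Z.left.obj.obj θ :=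
    element (τ ⟨θ, Y.hom.hom.app θ y⟩ (ofElement y rfl))
  -- The base point is a free variable `x` so that it can be substituted, avoiding transport between
  -- fibres.
  have ht' (θ : Θ) (z : Y.left.obj.obj θ) (x : X.obj.obj θ) (hx : Y.hom.hom.app θ z = x)
      (y : (repOver X).obj (op ⟨θ, x⟩) ⟶ Y) (hy : element y = z) :
      t θ z = element (τ ⟨θ, x⟩ y) := by
    subst hx
    dsimp only [t]
    congr 2
    exact element_injective ((element_ofElement _ _).trans hy.symm)
  have ht (e : X.obj.Elements) (y : (repOver X).obj (op e) ⟶ Y) :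
      t e.1 (element y) = element (τ e y) :=
    ht' e.1 (element y) e.2 (element_over y) y rfl
  let a : Y.left ⟶ Z.left := ObjectProperty.homMk
    { app θ := ↾(t θ)
      naturality θ θ' f := by
        ext y
        let e : X.obj.Elements := ⟨θ, Y.hom.hom.app θ y⟩
        let e' : X.obj.Elements := ⟨θ', X.obj.map f e.2⟩
        let F : e ⟶ e' := ⟨f, rfl⟩
        have h := ht e' ((repOver X).map F.op ≫ ofElement y rfl)
        rw [hτ, element_map_comp, element_map_comp, element_ofElement] at h
        exact h }
  refine ⟨Over.homMk a ?_, fun e y => element_injective (ht e y)⟩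
  ext θ y
  exact element_over (τ ⟨θ, Y.hom.hom.app θ y⟩ (ofElement y rfl))

/-- An element of a fibre of an abelian group object over `X`. -/
def toFibre {G : AbObj (Over X)} {e : X.obj.Elements} (y : (repOver X).obj (op e) ⟶ G.obj) :
    ((fibres X).obj G).obj e := y

/-- The map to the functor of fibres of an abelian group object `G` given by a map to `G`. -/
def fibreMap {Y : Over X} {G : AbObj (Over X)} (a : Y ⟶ G.obj) :
    (freeFibres X).obj Y ⟶ (fibres X).obj G :=
  freeFibresDesc (fun _ y => toFibre (y ≫ a)) (fun _ _ => Category.assoc _ _ _)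

lemma fibreMap_generator {Y : Over X} {G : AbObj (Over X)} (a : Y ⟶ G.obj)
    {e : X.obj.Elements} (y : (repOver X).obj (op e) ⟶ Y) :
    (fibreMap a).app e (generator y) = toFibre (y ≫ a) :=
  freeFibresDesc_generator (fun _ y => toFibre (y ≫ a)) (fun _ _ => Category.assoc _ _ _) y

lemma fibreMap_add {Y : Over X} {G : AbObj (Over X)} (a b : Y ⟶ G.obj) :
    fibreMap (a + b) = fibreMap a + fibreMap b := by
  refine freeFibres_hom_ext fun e y => ?_
  change _ = (fibreMap a).app e (generator y) + (fibreMap b).app e (generator y)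
  rw [fibreMap_generator, fibreMap_generator, fibreMap_generator]
  exact G.comp_add y a b

/-- Maps over `X` to an abelian group object `G` correspond to maps to the functor of fibres
of `G`. -/
def homToFibres (Y : Over X) (G : AbObj (Over X)) :
    (Y ⟶ G.obj) ≃+ ((freeFibres X).obj Y ⟶ (fibres X).obj G) :=
  AddEquiv.ofBijective (AddMonoidHom.mk' fibreMap fibreMap_add)
    ⟨fun a b h => over_hom_ext fun e y => by
        have := ConcreteCategory.congr_hom (congrArg (fun φ => φ.app e) h) (generator y)
        exact ((fibreMap_generator a y).symm.trans this).trans (fibreMap_generator b y),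
      fun φ => by
        obtain ⟨a, ha⟩ := exists_over_hom (Y := Y) (Z := G.obj)
          (fun e y => φ.app e (generator y)) (fun f y => by
            have := ConcreteCategory.congr_hom (φ.naturality f) (generator y)
            refine Eq.trans ?_ this
            exact congrArg (φ.app _) (freeFibres_obj_map_generator f y).symm)
        refine ⟨a, freeFibres_hom_ext fun e y => ?_⟩
        exact (fibreMap_generator a y).trans (ha e y)⟩

lemma homToFibres_generator {Y : Over X} {G : AbObj (Over X)} (a : Y ⟶ G.obj)
    {e : X.obj.Elements} (y : (repOver X).obj (op e) ⟶ Y) :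
    (homToFibres Y G a).app e (generator y) = toFibre (y ≫ a) :=
  fibreMap_generator a y

lemma homToFibres_comp {Y Y' : Over X} {G : AbObj (Over X)} (u : Y' ⟶ Y) (a : Y ⟶ G.obj) :
    homToFibres Y' G (u ≫ a) = (freeFibres X).map u ≫ homToFibres Y G a := by
  refine freeFibres_hom_ext fun e y => ?_
  rw [homToFibres_generator]
  refine Eq.trans ?_ (congrArg ((homToFibres Y G a).app e) (freeFibres_map_generator u y).symm)
  rw [homToFibres_generator, Category.assoc]

lemma homToFibres_comp_hom {Y : Over X} {G G' : AbObj (Over X)} (a : Y ⟶ G.obj) (g : G ⟶ G') :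
    homToFibres Y G' (a ≫ g.hom) = homToFibres Y G a ≫ (fibres X).map g := by
  refine freeFibres_hom_ext fun e y => ?_
  rw [homToFibres_generator]
  refine Eq.trans ?_ (congrArg (((fibres X).map g).app e) (homToFibres_generator a y).symm)
  exact (Category.assoc _ _ _).symm

/-- `Y` is the coproduct in algebras over `X` of a family of representable algebras over `X`. -/
def IsSumOfRepresentables (Y : Over X) {I : Type w} (e : I → X.obj.Elements)
    (y : ∀ i, (repOver X).obj (op (e i)) ⟶ Y) : Prop :=
  ∀ (Z : Over X) (z : ∀ i, (repOver X).obj (op (e i)) ⟶ Z), ∃! a : Y ⟶ Z, ∀ i, y i ≫ a = z i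

/-- The contravariant functor represented by `M` on algebras over `X` sends coproducts of
representable algebras to products. -/
def IsProductPreserving (M : X.obj.Elements ⥤ AddCommGrpCat.{w}) : Prop :=
  ∀ ⦃Y : Over X⦄ ⦃I : Type w⦄ ⦃e : I → X.obj.Elements⦄
    ⦃y : ∀ i, (repOver X).obj (op (e i)) ⟶ Y⦄, IsSumOfRepresentables Y e y →
      ∀ m : ∀ i, M.obj (e i), ∃! φ : (freeFibres X).obj Y ⟶ M,
        ∀ i, φ.app (e i) (generator (y i)) = m i

namespace IsProductPreserving

variable {M M' M'' : X.obj.Elements ⥤ AddCommGrpCat.{w}}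

lemma hom_ext (hM : IsProductPreserving M) {Y : Over X} {I : Type w} {e : I → X.obj.Elements}
    {y : ∀ i, (repOver X).obj (op (e i)) ⟶ Y} (hy : IsSumOfRepresentables Y e y)
    {φ φ' : (freeFibres X).obj Y ⟶ M}
    (h : ∀ i, φ.app (e i) (generator (y i)) = φ'.app (e i) (generator (y i))) : φ = φ' :=
  (hM hy fun i => φ'.app (e i) (generator (y i))).unique h (fun _ => rfl)

/-- By `homToFibres`, this is the universal property of the coproduct tested on `G.obj`. -/
lemma fibres (G : AbObj (Over X)) : IsProductPreserving ((ThetaAlg.fibres X).obj G) := by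
  intro Y I e y hy m
  obtain ⟨a, ha, ha'⟩ := hy G.obj m
  refine ⟨homToFibres Y G a, fun i => (homToFibres_generator a (y i)).trans (ha i), fun φ hφ => ?_⟩
  obtain ⟨b, rfl⟩ := (homToFibres Y G).surjective φ
  exact congrArg _ (ha' b fun i => (homToFibres_generator b (y i)).symm.trans (hφ i))

lemma of_iso (hM : IsProductPreserving M) (i : M ≅ M') : IsProductPreserving M' := by
  intro Y I e y hy m
  obtain ⟨φ, hφ, -⟩ := hM hy fun j => i.inv.app (e j) (m j)
  refine ⟨φ ≫ i.hom, fun j => ?_, fun φ' hφ' => ?_⟩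
  · refine (congrArg (i.hom.app (e j)) (hφ j)).trans ?_
    exact ConcreteCategory.congr_hom (congrArg (fun f => f.app (e j)) i.inv_hom_id) (m j)
  · rw [← Iso.comp_inv_eq]
    refine hM.hom_ext hy fun j => ?_
    exact (congrArg (i.inv.app (e j)) (hφ' j)).trans (hφ j).symm

lemma of_isZero (hM : IsZero M) : IsProductPreserving M := by
  intro Y I e y hy m
  refine ⟨0, fun i => ?_, fun φ _ => hM.eq_of_tgt _ _⟩
  exact ConcreteCategory.congr_hom
    (congrArg (fun f : M ⟶ M => f.app (e i)) (hM.eq_of_tgt 0 (𝟙 M))) (m i)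

lemma of_kernel (hM : IsProductPreserving M) (hM' : IsProductPreserving M') {g : M ⟶ M'}
    {ι : M'' ⟶ M} {w : ι ≫ g = 0} (hι : IsLimit (KernelFork.ofι ι w)) :
    IsProductPreserving M'' := by
  intro Y I e y hy m
  have : Mono ι := mono_of_isLimit_fork hι
  obtain ⟨φ, hφ, -⟩ := hM hy fun i => ι.app (e i) (m i)
  have hφg : φ ≫ g = 0 := hM'.hom_ext hy fun i =>
    (congrArg (g.app (e i)) (hφ i)).trans
      (ConcreteCategory.congr_hom (congrArg (fun f => f.app (e i)) w) (m i))
  obtain ⟨ψ, hψ⟩ := KernelFork.IsLimit.lift' hι φ hφg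
  have hψ : ψ ≫ ι = φ := hψ
  refine ⟨ψ, fun i => ?_, fun ψ' hψ' => ?_⟩
  · apply (AddCommGrpCat.mono_iff_injective (ι.app (e i))).1 inferInstance
    rw [← hφ i, ← hψ]
    rfl
  · rw [← cancel_mono ι, hψ]
    refine hM.hom_ext hy fun i => ?_
    exact (congrArg (ι.app (e i)) (hψ' i)).trans (hφ i).symm

/-- Preimages of the values on the generators `y i` can be chosen independently: they extend to a
morphism into `M`, and the uniqueness clause for `M'` shows that it is a lift. -/
lemma exists_lift (hM : IsProductPreserving M) (hM' : IsProductPreserving M') {Y : Over X}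
    {I : Type w} {e : I → X.obj.Elements} {y : ∀ i, (repOver X).obj (op (e i)) ⟶ Y}
    (hy : IsSumOfRepresentables Y e y) (p : M ⟶ M') [Epi p] (φ : (freeFibres X).obj Y ⟶ M') :
    ∃ ψ : (freeFibres X).obj Y ⟶ M, ψ ≫ p = φ := by
  choose m hm using fun i => (AddCommGrpCat.epi_iff_surjective (p.app (e i))).1 inferInstance
    (φ.app (e i) (generator (y i)))
  obtain ⟨ψ, hψ, -⟩ := hM hy m
  exact ⟨ψ, hM'.hom_ext hy fun i => (congrArg (p.app (e i)) (hψ i)).trans (hm i)⟩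

end IsProductPreserving

/-- `Y` is a retract of a coproduct of representable algebras over `X`. -/
def IsRetractOfSum (Y : Over X) : Prop :=
  ∃ (Y' : Over X) (I : Type w) (e : I → X.obj.Elements) (y : ∀ i, (repOver X).obj (op (e i)) ⟶ Y'),
    IsSumOfRepresentables Y' e y ∧ Nonempty (Retract Y Y')

lemma IsRetractOfSum.exists_lift {Y : Over X} (hY : IsRetractOfSum Y)
    {M M' : X.obj.Elements ⥤ AddCommGrpCat.{w}} (hM : IsProductPreserving M)
    (hM' : IsProductPreserving M') (p : M ⟶ M') [Epi p] (φ : (freeFibres X).obj Y ⟶ M') :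
    ∃ ψ : (freeFibres X).obj Y ⟶ M, ψ ≫ p = φ := by
  obtain ⟨Y', I, e, y, hy, ⟨r⟩⟩ := hY
  obtain ⟨ψ, hψ⟩ := hM.exists_lift hM' hy p ((freeFibres X).map r.r ≫ φ)
  refine ⟨(freeFibres X).map r.i ≫ ψ, ?_⟩
  rw [Category.assoc, hψ, ← Category.assoc, ← (freeFibres X).map_comp, r.retract,
    (freeFibres X).map_id,
    Category.id_comp]

/-- Projectivity of the terms of `P` in the functor category is not needed. It suffices that cycles
and boundaries of `Q` are product preserving, and both are kernels between functors already known to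
be so. -/
lemma liftsAgainst {P Q : ChainComplex (X.obj.Elements ⥤ AddCommGrpCat.{w}) ℕ} (n : ℕ)
    (hP : ∀ p, ∃ Y : Over X, IsRetractOfSum Y ∧ P.X p = (freeFibres X).obj Y)
    (hQ : ∀ q, IsProductPreserving (Q.X q)) (hn : IsProductPreserving (Q.homology n))
    (hQ₀ : ∀ q, q ≠ n → IsZero (Q.homology q)) : LiftsAgainst P Q n := by
  have hlift (p : ℕ) {M M' : X.obj.Elements ⥤ AddCommGrpCat.{w}} (hM : IsProductPreserving M)
      (hM' : IsProductPreserving M') (f : M ⟶ M') (_ : Epi f) (φ : P.X p ⟶ M') :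
      ∃ ψ : P.X p ⟶ M, ψ ≫ f = φ := by
    obtain ⟨Y, hY, h⟩ := hP p
    obtain ⟨ψ, hψ⟩ := hY.exists_lift hM hM' f (eqToHom h.symm ≫ φ)
    exact ⟨eqToHom h ≫ ψ, by simp [hψ]⟩
  have hH (q : ℕ) : IsProductPreserving (Q.homology q) := by
    by_cases hq : q = n
    · exact hq ▸ hn
    · exact .of_isZero (hQ₀ q hq)
  have hZ (q : ℕ) : IsProductPreserving (Q.cycles q) :=
    (hQ q).of_kernel (hQ _) (Q.cyclesIsKernel q _ rfl)
  have hB (p q : ℕ) (z : P.X p ⟶ Q.cycles q) (hz : z ≫ Q.homologyπ q = 0) :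
      ∃ b : P.X p ⟶ Q.X (q + 1), b ≫ Q.toCycles (q + 1) q = z := by
    -- Boundaries are treated as the kernel of `homologyπ`, not as an image, since product
    -- preservation passes to kernels.
    have hS := ShortComplex.exact_of_g_is_cokernel
      (ShortComplex.mk (Q.toCycles (q + 1) q) (Q.homologyπ q) (by simp))
      (Q.homologyIsCokernel (q + 1) q (by simp))
    have := hS.epi_kernelLift
    obtain ⟨b, hb⟩ := hlift p (hQ (q + 1))
      ((hZ q).of_kernel (hH q) (w := kernel.condition _) (kernelIsKernel (Q.homologyπ q)))
        _ this (kernel.lift _ z hz)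
    refine ⟨b, ?_⟩
    simpa using hb =≫ kernel.ι (Q.homologyπ q)
  refine ⟨fun p q hq a ha => ?_, fun p c => hlift p (hZ n) (hH n) _ inferInstance c,
    fun p => hB p n⟩
  obtain ⟨b, hb⟩ := hB p q (Q.liftCycles a _ rfl (ha _)) ((hQ₀ q hq).eq_of_tgt _ _)
  exact ⟨b, by simpa using hb =≫ Q.iCycles q⟩

end ThetaAlg

/-! ### Free algebras and cofibrant objects -/

namespace ThetaAlg

variable {Θ : Type w} [SmallCategory Θ] {X : ThetaAlg Θ}

lemma IsSumOfRepresentables.sigma {K : Type} {N : K → Over X} {I : K → Type w}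
    {e : ∀ k, I k → X.obj.Elements} {y : ∀ k i, (repOver X).obj (op (e k i)) ⟶ N k}
    (hN : ∀ k, IsSumOfRepresentables (N k) (e k) (y k)) {c : Cofan N} (hc : IsColimit c) :
    IsSumOfRepresentables c.pt (I := Σ k, I k) (fun j => e j.1 j.2)
      (fun j => y j.1 j.2 ≫ c.inj j.1) := by
  intro Z z
  choose a ha ha' using fun k => hN k Z (fun i => z ⟨k, i⟩)
  refine ⟨Cofan.IsColimit.desc hc a, ?_, fun b hb => ?_⟩
  · rintro ⟨k, i⟩
    simpa using ha k i
  · refine Cofan.IsColimit.hom_ext hc _ _ fun k => ?_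
    rw [Cofan.IsColimit.fac]
    exact ha' k _ fun i => (Category.assoc _ _ _).symm.trans (hb ⟨k, i⟩)

end ThetaAlg

namespace GroupTheory

open ThetaAlg

variable {Θ : Type w} [SmallCategory Θ] [CartesianMonoidalCategory Θ] {T : GroupTheory Θ}
  {X : ThetaAlg Θ}

/-- Each basis element, with its image in `X`, is an element of a fibre and so a map from a
representable. Freeness gives the map to `Z.left`; uniqueness of maps to `X` shows that it lies over
`X`. -/
lemma IsFree.exists_isSumOfRepresentables {Y : Over X} (hY : T.IsFree Y.left) :
    ∃ (I : Type w) (e : I → X.obj.Elements) (y : ∀ i, (repOver X).obj (op (e i)) ⟶ Y),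
      IsSumOfRepresentables Y e y := by
  obtain ⟨B, b, hb⟩ := hY
  refine ⟨Σ s, B s, fun i => ⟨i.1, Y.hom.hom.app _ (b i.1 i.2)⟩,
    fun i => ofElement (b i.1 i.2) rfl, fun Z z => ?_⟩
  obtain ⟨φ, hφ, hφ'⟩ := hb Z.left (fun s t => element (z ⟨s, t⟩))
  have hover : φ ≫ Z.hom = Y.hom := by
    refine (hb X fun s t => Y.hom.hom.app _ (b s t)).unique (fun s t => ?_) (fun s t => rfl)
    exact (congrArg (Z.hom.hom.app (s : Θ)) (hφ s t)).trans (element_over (z ⟨s, t⟩))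
  refine ⟨Over.homMk φ hover, fun i => ?_, fun a ha => ?_⟩
  · apply element_injective
    refine Eq.trans ?_ (hφ i.1 i.2)
    exact congrArg (φ.hom.app (i.1 : Θ)) (element_ofElement _ _)
  · ext1
    refine hφ' _ fun s t => ?_
    have h := element_ofElement (Y := Y) (e := ⟨s, Y.hom.hom.app _ (b s t)⟩) (b s t) rfl
    exact (congrArg (a.left.hom.app (s : Θ)) h).symm.trans (congrArg element (ha ⟨s, t⟩))

/-- A splitting presents each term of `V'` as a coproduct of the free pieces `s.N`. -/
lemma IsCofibrant.isRetractOfSum {V : SimplicialObject (Over X)} (hV : T.IsCofibrant V) (k : ℕ) :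
    IsRetractOfSum (V _⦋k⦌) := by
  obtain ⟨V', s, hs, ⟨r⟩⟩ := hV
  choose I e y hy using fun k => (hs k).exists_isSumOfRepresentables
  exact ⟨_, _, _, _, IsSumOfRepresentables.sigma
    (fun A : SimplicialObject.Splitting.IndexSet (op ⦋k⦌) => hy A.1.unop.len) (s.isColimit _),
    ⟨r.map ((evaluation _ _).obj (op ⦋k⦌))⟩⟩

end GroupTheory

/-! ### Simplicial homotopies from families indexed by simplices of the interval -/

section SimplicialHomotopy

open SimplexCategory

variable {C : Type u} [Category.{v} C] {X Y : SimplicialObject C}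

/-- The combinatorial simplicial homotopy associated with a family of maps
`X _⦋n⦌ ⟶ Y _⦋n⦌` indexed by the simplices of the interval. -/
def SimplicialObject.homotopyOfFamily (ζ : ∀ {n : ℕ}, (⦋n⦌ ⟶ ⦋1⦌) → (X _⦋n⦌ ⟶ Y _⦋n⦌))
    (hζ : ∀ {n m : ℕ} (θ : ⦋n⦌ ⟶ ⦋m⦌) (τ : ⦋m⦌ ⟶ ⦋1⦌),
      X.map θ.op ≫ ζ (θ ≫ τ) = ζ τ ≫ Y.map θ.op)
    {f g : X ⟶ Y} (hf : ∀ n, ζ (toMk₁ (Fin.last (n + 1))) = f.app (op ⦋n⦌))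
    (hg : ∀ n, ζ (toMk₁ (0 : Fin (n + 2))) = g.app (op ⦋n⦌)) :
    SimplicialObject.Homotopy f g :=
  have hδ {n : ℕ} (i : Fin (n + 2)) (τ : ⦋n + 1⦌ ⟶ ⦋1⦌) :
    ζ τ ≫ Y.δ i = X.δ i ≫ ζ (δ i ≫ τ) := (hζ _ τ).symm
  have hσ {n : ℕ} (i : Fin (n + 1)) (τ : ⦋n⦌ ⟶ ⦋1⦌) :
    ζ τ ≫ Y.σ i = X.σ i ≫ ζ (σ i ≫ τ) := (hζ _ τ).symm
  -- This is the `i`-th top simplex of the prism `Δⁿ × Δ¹`: the vertex doubled by `σ i` is the one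
  -- at which the interval coordinate jumps, being `0` exactly up to position `i`.
  { h {n} i := X.σ i ≫ ζ (toMk₁ i.succ.castSucc)
    h_zero_comp_δ_zero n := by
      rw [Category.assoc, hδ, δ_comp_toMk₁_of_lt _ _ (by simp), ← Category.assoc]
      erw [X.δ_comp_σ_self (i := 0)]
      rw [Category.id_comp, ← hg]
      rfl
    h_last_comp_δ_last n := by
      rw [Category.assoc, hδ, δ_comp_toMk₁_of_le _ _ (by simp), ← Category.assoc]
      erw [X.δ_comp_σ_succ (i := Fin.last n)]
      rw [Category.id_comp, ← hf]
      rfl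
    h_succ_comp_δ_castSucc_of_lt i j hij := by
      rw [Category.assoc, hδ, δ_comp_toMk₁_of_lt _ _ (by
        simp only [Fin.lt_def, Fin.le_def, Fin.val_castSucc, Fin.val_succ] at hij ⊢; omega),
        ← Category.assoc, X.δ_comp_σ_of_le hij, Category.assoc]
      rfl
    h_succ_comp_δ_castSucc_succ j := by
      rw [Category.assoc, Category.assoc, hδ, hδ, δ_comp_toMk₁_of_lt _ _ (by simp [Fin.lt_def]),
        δ_comp_toMk₁_of_le _ _ (by simp), ← Category.assoc, ← Category.assoc]
      have h₁ := X.δ_comp_σ_self (i := j.succ)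
      have h₂ := X.δ_comp_σ_succ (i := j.castSucc)
      rw [← Fin.succ_castSucc] at h₁
      rw [h₁, h₂]
      rfl
    h_castSucc_comp_δ_succ_of_lt i j hij := by
      rw [Category.assoc, hδ, δ_comp_toMk₁_of_le _ _ (by
        simp only [Fin.lt_def, Fin.le_def, Fin.val_castSucc, Fin.val_succ] at hij ⊢; omega),
        ← Category.assoc, X.δ_comp_σ_of_gt hij, Category.assoc]
      rfl
    h_comp_σ_castSucc_of_le i j hij := by
      rw [Category.assoc, hσ, σ_comp_toMk₁_of_lt _ _ (by
        simp only [Fin.lt_def, Fin.le_def, Fin.val_castSucc, Fin.val_succ] at hij ⊢; omega),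
        ← Category.assoc, X.σ_comp_σ hij, Category.assoc]
      rfl
    h_comp_σ_succ_of_lt i j hij := by
      rw [Category.assoc, hσ, σ_comp_toMk₁_of_le _ _ (by
        simp only [Fin.le_def, Fin.val_castSucc, Fin.val_succ] at hij ⊢; omega),
        ← Category.assoc, ← X.σ_comp_σ hij, Category.assoc]
      rfl }

end SimplicialHomotopy

namespace SimplexCategory

/-- The map `[k] ⟶ [0] ⋆ [k]` which sends to the cone point the part where `α` vanishes, and is
the inclusion elsewhere. -/
def coneSection {k : SimplexCategory} (α : k ⟶ ⦋1⦌) : k ⟶ cone.obj k :=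
  mkHom ⟨fun i => if α.toOrderHom i = 0 then 0 else i.succ, by
    intro i j hij
    have := α.toOrderHom.monotone hij
    dsimp only
    split_ifs with h₁ h₂ h₂
    · exact le_rfl
    · exact Fin.zero_le _
    · rw [h₂] at this
      exact absurd (le_antisymm this (Fin.zero_le _)) h₁
    · exact Fin.succ_le_succ_iff.2 hij⟩

lemma coneSection_apply_of_eq_zero {k : SimplexCategory} {α : k ⟶ ⦋1⦌} {i : Fin (k.len + 1)}
    (h : α.toOrderHom i = 0) : (coneSection α).toOrderHom i = 0 := if_pos h

lemma coneSection_apply_of_ne_zero {k : SimplexCategory} {α : k ⟶ ⦋1⦌} {i : Fin (k.len + 1)}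
    (h : α.toOrderHom i ≠ 0) : (coneSection α).toOrderHom i = i.succ := if_neg h

/-- This naturality is what turns a map into the décalage into an edge of the function complex.
`coneSection_one` and `coneSection_zero` compute the two ends. -/
lemma comp_coneSection {k l : SimplexCategory} (θ : l ⟶ k) (α : k ⟶ ⦋1⦌) :
    θ ≫ coneSection α = coneSection (θ ≫ α) ≫ cone.map θ := by
  ext i : 3
  change (coneSection α).toOrderHom (θ.toOrderHom i) =
    (cone.map θ).toOrderHom ((coneSection (θ ≫ α)).toOrderHom i)
  by_cases h : α.toOrderHom (θ.toOrderHom i) = 0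
  · rw [coneSection_apply_of_eq_zero h, coneSection_apply_of_eq_zero (α := θ ≫ α) h]
    rfl
  · rw [coneSection_apply_of_ne_zero h, coneSection_apply_of_ne_zero (α := θ ≫ α) h]
    rfl

lemma coneSection_one (k : SimplexCategory) :
    coneSection (isTerminalZero.from k ≫ δ 0) = toCone.app k := by
  ext i : 3
  rfl

lemma coneSection_zero (k : SimplexCategory) (θ : ⦋0⦌ ⟶ k) :
    coneSection (isTerminalZero.from k ≫ δ 1) =
      isTerminalZero.from k ≫ (show ⦋0⦌ ⟶ cone.obj ⦋0⦌ from δ (n := 0) 1) ≫ cone.map θ := by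
  ext i : 3
  rfl

lemma toMk₁_zero (n : ℕ) : toMk₁ (0 : Fin (n + 2)) = isTerminalZero.from ⦋n⦌ ≫ δ 0 := by
  ext i : 3
  rfl

lemma toMk₁_last (n : ℕ) : toMk₁ (Fin.last (n + 1)) = isTerminalZero.from ⦋n⦌ ≫ δ 1 := by
  ext i : 3
  exact toMk₁_of_castSucc_lt _ _ (Fin.castSucc_lt_last i)

end SimplexCategory

/-! ### Components of the function complex as homotopy classes of chain maps -/

namespace ThetaAlg

open AlgebraicTopology SimplexCategory

variable {Θ : Type w} [SmallCategory Θ] {X : ThetaAlg Θ} {V V' : SimplicialObject (Over X)}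
  {E E' : SimplicialObject (AbObj (Over X))}

/-- The simplicial object of free abelian groups on the fibres. -/
abbrev freeFibresObj (V : SimplicialObject (Over X)) :
    SimplicialObject (X.obj.Elements ⥤ AddCommGrpCat.{w}) :=
  ((SimplicialObject.whiskering _ _).obj (freeFibres X)).obj V

/-- The simplicial object of fibres. -/
abbrev fibresObj (E : SimplicialObject (AbObj (Over X))) :
    SimplicialObject (X.obj.Elements ⥤ AddCommGrpCat.{w}) :=
  ((SimplicialObject.whiskering _ _).obj (fibres X)).obj E

/-- `homToFibres` for the terms of simplicial objects. -/
def homToFibresObj (V : SimplicialObject (Over X)) (E : SimplicialObject (AbObj (Over X)))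
    (k l : SimplexCategoryᵒᵖ) :
    (V.obj k ⟶ (E.obj l).obj) ≃+ ((freeFibresObj V).obj k ⟶ (fibresObj E).obj l) :=
  homToFibres (V.obj k) (E.obj l)

lemma homToFibresObj_comp {k l m : SimplexCategoryᵒᵖ} (θ : k ⟶ l) (a : V.obj l ⟶ (E.obj m).obj) :
    homToFibresObj V E k m (V.map θ ≫ a) = (freeFibresObj V).map θ ≫ homToFibresObj V E l m a :=
  homToFibres_comp (V.map θ) a

lemma homToFibresObj_comp_hom {k l m : SimplexCategoryᵒᵖ} (a : V.obj k ⟶ (E.obj l).obj)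
    (θ : l ⟶ m) :
    homToFibresObj V E k m (a ≫ (E.map θ).hom) = homToFibresObj V E k l a ≫ (fibresObj E).map θ :=
  homToFibres_comp_hom a (E.map θ)

/-- The map `V_k ⟶ E_k` that a simplex of the function complex assigns to a simplex of a standard
simplex. -/
def mapAt {j : ℕ} (z : (mapGroup V E) _⦋j⦌) {k : SimplexCategory} (τ : k ⟶ ⦋j⦌) :
    V.obj (op k) ⟶ (E.obj (op k)).obj :=
  Functor.HomObj.app (show Functor.HomObj V (forgetAb E) (coyoneda.obj (op (op ⦋j⦌))) from z) (op k)
    (show op ⦋j⦌ ⟶ op k from τ.op)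

lemma mapAt_naturality {j : ℕ} (z : (mapGroup V E) _⦋j⦌) {k l : SimplexCategory} (θ : l ⟶ k)
    (τ : k ⟶ ⦋j⦌) : V.map θ.op ≫ mapAt z (θ ≫ τ) = mapAt z τ ≫ (E.map θ.op).hom :=
  Functor.HomObj.naturality
    (show Functor.HomObj V (forgetAb E) (coyoneda.obj (op (op ⦋j⦌))) from z) θ.op
    (show op ⦋j⦌ ⟶ op k from τ.op)

lemma mapAt_δ {j : ℕ} (z : (mapGroup V E) _⦋j + 1⦌) (i : Fin (j + 2)) {k : SimplexCategory}
    (τ : k ⟶ ⦋j⦌) : mapAt ((mapGroup V E).δ i z) τ = mapAt z (τ ≫ δ i) := rfl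

lemma mapAt_ext {j : ℕ} {z z' : (mapGroup V E) _⦋j⦌}
    (h : ∀ (k : SimplexCategory) (τ : k ⟶ ⦋j⦌), mapAt z τ = mapAt z' τ) : z = z' :=
  Functor.HomObj.ext (funext fun k => funext fun a => h k.unop a.unop)

/-- A natural family of maps defines a simplex of the function complex. -/
def simplexOfFamily {j : ℕ}
    (t : ∀ {k : SimplexCategory}, (k ⟶ ⦋j⦌) → (V.obj (op k) ⟶ (E.obj (op k)).obj))
    (ht : ∀ {k l : SimplexCategory} (θ : l ⟶ k) (τ : k ⟶ ⦋j⦌),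
      V.map θ.op ≫ t (θ ≫ τ) = t τ ≫ (E.map θ.op).hom) : (mapGroup V E) _⦋j⦌ :=
  show Functor.HomObj V (forgetAb E) (coyoneda.obj (op (op ⦋j⦌))) from
    { app k a := t (show k.unop ⟶ ⦋j⦌ from Quiver.Hom.unop a)
      naturality θ a := ht θ.unop (Quiver.Hom.unop a) }

lemma mapAt_simplexOfFamily {j : ℕ}
    (t : ∀ {k : SimplexCategory}, (k ⟶ ⦋j⦌) → (V.obj (op k) ⟶ (E.obj (op k)).obj))
    (ht : ∀ {k l : SimplexCategory} (θ : l ⟶ k) (τ : k ⟶ ⦋j⦌),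
      V.map θ.op ≫ t (θ ≫ τ) = t τ ≫ (E.map θ.op).hom) {k : SimplexCategory} (τ : k ⟶ ⦋j⦌) :
    mapAt (simplexOfFamily t ht) τ = t τ := rfl

/-- The simplicial map to the fibres of `E` corresponding to a vertex of the function complex. -/
def vertexMap (V : SimplicialObject (Over X)) (E : SimplicialObject (AbObj (Over X))) :
    (mapGroup V E) _⦋0⦌ →+ (freeFibresObj V ⟶ fibresObj E) :=
  AddMonoidHom.mk' (fun z =>
    { app k := homToFibresObj V E k k (mapAt z (isTerminalZero.from k.unop))
      naturality k l θ := by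
        rw [← homToFibresObj_comp, ← homToFibresObj_comp_hom]
        exact congrArg _ (mapAt_naturality z θ.unop (isTerminalZero.from k.unop)) })
    (fun z z' => by
      apply NatTrans.ext
      funext k
      exact map_add (homToFibresObj V E k k) _ _)

lemma vertexMap_app (z : (mapGroup V E) _⦋0⦌) (k : SimplexCategoryᵒᵖ) :
    (vertexMap V E z).app k = homToFibresObj V E k k (mapAt z (isTerminalZero.from k.unop)) := rfl

lemma vertexMap_surjective : Function.Surjective (vertexMap V E) := by
  intro f
  refine ⟨simplexOfFamily (fun {k} _ => (homToFibresObj V E (op k) (op k)).symm (f.app (op k)))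
    (fun {k l} θ _ => ?_), ?_⟩
  · apply (homToFibresObj V E (op k) (op l)).injective
    rw [homToFibresObj_comp, homToFibresObj_comp_hom]
    rw [AddEquiv.apply_symm_apply, AddEquiv.apply_symm_apply]
    exact f.naturality θ.op
  · apply NatTrans.ext
    funext k
    rw [vertexMap_app, mapAt_simplexOfFamily]
    exact (homToFibresObj V E k k).apply_symm_apply _

/-- An edge of the function complex gives a simplicial homotopy. -/
def homotopyOfEdge (z : (mapGroup V E) _⦋1⦌) : SimplicialObject.Homotopy
    (vertexMap V E ((mapGroup V E).δ 1 z)) (vertexMap V E ((mapGroup V E).δ 0 z)) :=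
  SimplicialObject.homotopyOfFamily
    (fun {n} τ => homToFibresObj V E (op ⦋n⦌) (op ⦋n⦌) (mapAt z τ))
    (fun θ τ => by rw [← homToFibresObj_comp, ← homToFibresObj_comp_hom, mapAt_naturality])
    (fun n => by rw [toMk₁_last, vertexMap_app, mapAt_δ])
    (fun n => by rw [toMk₁_zero, vertexMap_app, mapAt_δ])

/-- The edge sends a simplex `τ` of the interval to the lift followed by restriction along
`coneSection τ`. At the end `1` this is the map `decalageFace`; at the end `0` it factors through
the cone point, where `hf₀` makes it zero. -/
lemma exists_edge {z : (mapGroup V E) _⦋0⦌}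
    {f : freeFibresObj V ⟶ SimplicialObject.decalage (fibresObj E)}
    (hf : f ≫ SimplicialObject.decalageFace _ = vertexMap V E z)
    (hf₀ : (show (freeFibresObj V) _⦋0⦌ ⟶ (fibresObj E) _⦋1⦌ from f.app (op ⦋0⦌)) ≫
      (fibresObj E).δ 1 = 0) :
    ∃ y : (mapGroup V E) _⦋1⦌, (mapGroup V E).δ 1 y = 0 ∧ (mapGroup V E).δ 0 y = z := by
  let f' (k : SimplexCategory) :
      (freeFibresObj V).obj (op k) ⟶ (fibresObj E).obj (op (cone.obj k)) :=
    f.app (op k)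
  have hf' {k l : SimplexCategory} (θ : l ⟶ k) : (freeFibresObj V).map θ.op ≫ f' l =
      f' k ≫ (fibresObj E).map (cone.map θ).op := f.naturality θ.op
  let t (k : SimplexCategory) : V.obj (op k) ⟶ (E.obj (op (cone.obj k))).obj :=
    (homToFibresObj V E _ _).symm (f' k)
  have ht (k : SimplexCategory) : homToFibresObj V E _ _ (t k) = f' k :=
    AddEquiv.apply_symm_apply _ _
  let y : (mapGroup V E) _⦋1⦌ := simplexOfFamily
    (fun {k} τ => t k ≫ (E.map (coneSection τ).op).hom) (fun {k l} θ τ => by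
      apply (homToFibresObj V E _ _).injective
      rw [homToFibresObj_comp, homToFibresObj_comp_hom, homToFibresObj_comp_hom,
        homToFibresObj_comp_hom, ht, ht, Category.assoc, ← Functor.map_comp, ← op_comp,
        comp_coneSection, ← Category.assoc, hf', Category.assoc, ← Functor.map_comp, ← op_comp])
  refine ⟨y, mapAt_ext fun k τ => ?_, mapAt_ext fun k τ => ?_⟩
  · rw [mapAt_δ, mapAt_simplexOfFamily]
    apply (homToFibresObj V E _ _).injective
    obtain rfl : τ = isTerminalZero.from k := isTerminalZero.hom_ext _ _
    let θ : ⦋0⦌ ⟶ k := SimplexCategory.const _ _ 0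
    have h₀ : f' ⦋0⦌ ≫ (fibresObj E).map (show ⦋0⦌ ⟶ cone.obj ⦋0⦌ from δ (n := 0) 1).op = 0 := hf₀
    rw [homToFibresObj_comp_hom, ht, coneSection_zero k θ, op_comp, op_comp, Functor.map_comp,
      Functor.map_comp, ← Category.assoc, ← Category.assoc, ← hf', Category.assoc _ (f' ⦋0⦌), h₀,
      comp_zero, zero_comp]
    exact (map_zero (homToFibresObj V E _ _)).symm
  · rw [mapAt_δ, mapAt_simplexOfFamily]
    apply (homToFibresObj V E _ _).injective
    obtain rfl : τ = isTerminalZero.from k := isTerminalZero.hom_ext _ _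
    rw [homToFibresObj_comp_hom, ht, coneSection_one]
    exact congrArg (fun g => NatTrans.app g (op k)) hf

/-- The chain map corresponding to a vertex of the function complex. -/
def vertexChainMap (V : SimplicialObject (Over X)) (E : SimplicialObject (AbObj (Over X))) :
    (mapGroup V E) _⦋0⦌ →+ ((alternatingFaceMapComplex _).obj (freeFibresObj V) ⟶
      (alternatingFaceMapComplex _).obj (fibresObj E)) :=
  AddMonoidHom.comp (Functor.mapAddHom (alternatingFaceMapComplex _)) (vertexMap V E)

/-- Edges give simplicial and hence chain homotopies. Conversely, a null homotopic map lifts to the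
décalage, and the lift is an edge from zero. -/
lemma component_eq_zero_iff (z : (mapGroup V E) _⦋0⦌) :
    component (mapGroup V E) z = 0 ↔ Nonempty (Homotopy (vertexChainMap V E z) 0) := by
  constructor
  · intro h
    -- Taking values in the homotopy category absorbs the passage from single edges to the
    -- equivalence relation they generate.
    let F := componentLift (mapGroup V E)
      (fun z => (HomotopyCategory.quotient _ _).map (vertexChainMap V E z))
      (fun z => HomotopyCategory.eq_of_homotopy _ _ (homotopyOfEdge z).toChainHomotopy)
    have h' := congrArg F h
    change (HomotopyCategory.quotient _ _).map (vertexChainMap V E z) =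
      (HomotopyCategory.quotient _ _).map (vertexChainMap V E 0) at h'
    rw [map_zero] at h'
    exact ⟨HomotopyCategory.homotopyOfEq _ _ h'⟩
  · intro h
    obtain ⟨f, hf, hf₀⟩ := exists_lift_decalage h
    obtain ⟨y, hy₁, hy₀⟩ := exists_edge hf hf₀
    have := component_face (mapGroup V E) y
    rw [hy₁, hy₀] at this
    exact this.symm

lemma exists_vertexChainMap_homotopic (φ : (alternatingFaceMapComplex _).obj (freeFibresObj V) ⟶
    (alternatingFaceMapComplex _).obj (fibresObj E)) :
    ∃ z, Nonempty (Homotopy (vertexChainMap V E z) φ) := by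
  obtain ⟨f, hf⟩ := exists_homotopic_map φ
  obtain ⟨z, rfl⟩ := vertexMap_surjective f
  exact ⟨z, hf⟩

end ThetaAlg

/-- An additive relation between abelian groups that is total on both sides, and relates elements
only to zero when they are zero, is the graph of an isomorphism. -/
lemma exists_addEquiv_of_relation {A B : Type*} [AddCommGroup A] [AddCommGroup B]
    (r : A → B → Prop) (hsub : ∀ {a a' b b'}, r a b → r a' b' → r (a - a') (b - b'))
    (hA : ∀ a, ∃ b, r a b) (hB : ∀ b, ∃ a, r a b) (h₀ : ∀ {a b}, r a b → (a = 0 ↔ b = 0)) :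
    ∃ e : A ≃+ B, ∀ a b, r a b ↔ e a = b := by
  have h₁ {a a' b b'} (h : r a b) (h' : r a' b') : a = a' ↔ b = b' := by
    rw [← sub_eq_zero, h₀ (hsub h h'), sub_eq_zero]
  have hadd {a a' b b'} (h : r a b) (h' : r a' b') : r (a + a') (b + b') := by
    have := hsub h (hsub (hsub h h) h')
    simpa using this
  choose f hf using hA
  choose g hg using hB
  refine ⟨{ toFun := f, invFun := g, left_inv := fun a => (h₁ (hg (f a)) (hf a)).2 rfl,
            right_inv := fun b => (h₁ (hf (g b)) (hg b)).1 rfl,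
            map_add' := fun a a' => (h₁ (hf (a + a')) (hadd (hf a) (hf a'))).1 rfl }, ?_⟩
  exact fun a b => ⟨fun h => (h₁ (hf a) h).1 rfl, fun h => h ▸ hf a⟩

/-! ### Representing cocycles in complexes of abelian groups -/

section CochainComplex

variable (D : CochainComplex AddCommGrpCat.{w} ℕ)

/-- A cochain represents a cohomology class. -/
def IsCocycleOf {n : ℕ} (x : D.homology n) (c : D.X n) : Prop :=
  ∃ z : D.cycles n, D.homologyπ n z = x ∧ D.iCycles n z = c

variable {D}

lemma exists_isCocycleOf {n : ℕ} (x : D.homology n) : ∃ c, IsCocycleOf D x c := by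
  obtain ⟨z, hz⟩ := (AddCommGrpCat.epi_iff_surjective (D.homologyπ n)).1 inferInstance x
  exact ⟨_, z, hz, rfl⟩

lemma IsCocycleOf.d_eq_zero {n : ℕ} {x : D.homology n} {c : D.X n} (h : IsCocycleOf D x c) :
    D.d n (n + 1) c = 0 := by
  obtain ⟨z, -, rfl⟩ := h
  exact ConcreteCategory.congr_hom (D.iCycles_d n (n + 1)) z

lemma IsCocycleOf.sub {n : ℕ} {x x' : D.homology n} {c c' : D.X n} (h : IsCocycleOf D x c)
    (h' : IsCocycleOf D x' c') : IsCocycleOf D (x - x') (c - c') := by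
  obtain ⟨z, rfl, rfl⟩ := h
  obtain ⟨z', rfl, rfl⟩ := h'
  exact ⟨z - z', map_sub _ _ _, map_sub _ _ _⟩

lemma IsCocycleOf.map {D' : CochainComplex AddCommGrpCat.{w} ℕ} (f : D ⟶ D') {n : ℕ}
    {x : D.homology n} {c : D.X n} (h : IsCocycleOf D x c) :
    IsCocycleOf D' (HomologicalComplex.homologyMap f n x) (f.f n c) := by
  obtain ⟨z, rfl, rfl⟩ := h
  exact ⟨HomologicalComplex.cyclesMap f n z,
    (ConcreteCategory.congr_hom (HomologicalComplex.homologyπ_naturality f n) z).symm,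
    ConcreteCategory.congr_hom (HomologicalComplex.cyclesMap_i f n) z⟩

lemma exists_isCocycleOf_of_d_eq_zero {n : ℕ} {c : D.X n} (h : D.d n (n + 1) c = 0) :
    ∃ x, IsCocycleOf D x c := by
  have hS := ShortComplex.exact_of_f_is_kernel
    (ShortComplex.mk (D.iCycles n) (D.d n (n + 1)) (by simp)) (D.cyclesIsKernel n (n + 1) (by simp))
  obtain ⟨z, hz⟩ := (ShortComplex.ab_exact_iff _).1 hS c h
  exact ⟨_, z, rfl, hz⟩

lemma IsCocycleOf.eq_zero_iff {m : ℕ} {x : D.homology (m + 1)} {c : D.X (m + 1)}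
    (h : IsCocycleOf D x c) : x = 0 ↔ ∃ b : D.X m, D.d m (m + 1) b = c := by
  obtain ⟨z, rfl, rfl⟩ := h
  have hi : Function.Injective (D.iCycles (m + 1)) :=
    (AddCommGrpCat.mono_iff_injective _).1 inferInstance
  constructor
  · intro hz
    have hS := ShortComplex.exact_of_g_is_cokernel
      (ShortComplex.mk (D.toCycles m (m + 1)) (D.homologyπ (m + 1)) (by simp))
      (D.homologyIsCokernel m (m + 1) (by simp))
    obtain ⟨b, hb⟩ := (ShortComplex.ab_exact_iff _).1 hS z hz
    have hb : D.toCycles m (m + 1) b = z := hb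
    refine ⟨b, ?_⟩
    rw [← hb]
    exact (ConcreteCategory.congr_hom (D.toCycles_i m (m + 1)) b).symm
  · rintro ⟨b, hb⟩
    have : D.toCycles m (m + 1) b = z := hi (by
      rw [← hb]
      exact ConcreteCategory.congr_hom (D.toCycles_i m (m + 1)) b)
    rw [← this]
    exact ConcreteCategory.congr_hom (D.toCycles_comp_homologyπ m (m + 1)) b

end CochainComplex

lemma sum_zsmul_apply {A B : AddCommGrpCat.{w}} {ι : Type*} [Fintype ι] (z : ι → ℤ)
    (f : ι → (A ⟶ B)) (a : A) : (∑ i, z i • f i) a = ∑ i, z i • f i a :=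
  (map_sum (AddMonoidHom.mk' (fun g : A ⟶ B => g a) (fun _ _ => rfl)) _ _).trans
    (Finset.sum_congr rfl fun i _ =>
      map_zsmul (AddMonoidHom.mk' (fun g : A ⟶ B => g a) (fun _ _ => rfl)) (z i) (f i))

/-! ### Comparison of cohomology with homotopy classes of maps -/

namespace ThetaAlg

open AlgebraicTopology

variable {Θ : Type w} [SmallCategory Θ] {X : ThetaAlg Θ} {V V' : SimplicialObject (Over X)}

/-- The cochain complex associated with `Hom(V, G)`. -/
abbrev homComplex (V : SimplicialObject (Over X)) (G : AbObj (Over X)) :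
    CochainComplex AddCommGrpCat.{w} ℕ :=
  (alternatingCofaceMapComplex AddCommGrpCat.{w}).obj (cosimplicialHom V G)

/-- Cochains are maps from the free abelian groups on the fibres to the fibres of the
coefficients. -/
def cochainEquiv (V : SimplicialObject (Over X)) (G : AbObj (Over X)) (n : ℕ) :
    (homComplex V G).X n ≃+
      (((alternatingFaceMapComplex _).obj (freeFibresObj V)).X n ⟶ (fibres X).obj G) :=
  homToFibres (V _⦋n⦌) G

lemma cochainEquiv_d {G : AbObj (Over X)} {n : ℕ} (c : (homComplex V G).X n) :
    cochainEquiv V G (n + 1) ((homComplex V G).d n (n + 1) c) =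
      ((alternatingFaceMapComplex _).obj (freeFibresObj V)).d (n + 1) n ≫ cochainEquiv V G n c := by
  have hd : (homComplex V G).d n (n + 1) =
      AlternatingCofaceMapComplex.objD (cosimplicialHom V G) n :=
    CochainComplex.of_d (fun k => (cosimplicialHom V G).obj ⦋k⦌)
      (AlternatingCofaceMapComplex.objD (cosimplicialHom V G)) n
  have h : (homComplex V G).d n (n + 1) c =
      ∑ i : Fin (n + 2), ((-1 : ℤ) ^ (i : ℕ)) • (V.δ i ≫ (show V _⦋n⦌ ⟶ G.obj from c)) := by
    rw [hd]
    exact sum_zsmul_apply _ _ c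
  rw [h, alternatingFaceMapComplex_obj_d, AlternatingFaceMapComplex.objD, Preadditive.sum_comp]
  refine (map_sum (homToFibres (V _⦋n + 1⦌) G) _ _).trans (Finset.sum_congr rfl fun i _ => ?_)
  rw [map_zsmul, Preadditive.zsmul_comp]
  exact congrArg _ (homToFibres_comp (V.δ i) c)

lemma cochainEquiv_map (a : V ⟶ V') {G G' : AbObj (Over X)} (g : G ⟶ G') {n : ℕ}
    (c : (homComplex V' G).X n) :
    cochainEquiv V G' n (((alternatingCofaceMapComplex AddCommGrpCat.{w}).map
      (cosimplicialHomMap a g)).f n c) =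
      ((alternatingFaceMapComplex _).map (((SimplicialObject.whiskering _ _).obj
        (freeFibres X)).map a)).f n ≫ cochainEquiv V' G n c ≫ (fibres X).map g := by
  refine (homToFibres_comp_hom (a.app (op ⦋n⦌) ≫ (show V' _⦋n⦌ ⟶ G.obj from c)) g).trans ?_
  rw [homToFibres_comp, Category.assoc]
  rfl

variable {E E' : SimplicialObject (AbObj (Over X))}

lemma vertexChainMap_mapGroupMap (a : V ⟶ V') (e : E ⟶ E') (z : (mapGroup V' E) _⦋0⦌) :
    vertexChainMap V E' ((mapGroupMap a e).app (op ⦋0⦌) z) =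
      (alternatingFaceMapComplex _).map (((SimplicialObject.whiskering _ _).obj
        (freeFibres X)).map a) ≫ vertexChainMap V' E z ≫
      (alternatingFaceMapComplex _).map (((SimplicialObject.whiskering _ _).obj
        (fibres X)).map e) := by
  change (alternatingFaceMapComplex _).map _ = _ ≫ (alternatingFaceMapComplex _).map _ ≫ _
  rw [← Functor.map_comp, ← Functor.map_comp]
  congr 1
  apply NatTrans.ext
  funext k
  refine (homToFibres_comp_hom
    (a.app k ≫ mapAt z (SimplexCategory.isTerminalZero.from k.unop)) (e.app k)).trans ?_
  rw [homToFibres_comp, Category.assoc]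
  rfl

/-- The homology of the alternating face map complex of the fibres maps isomorphically to the
homotopy groups. -/
def homologyToHomotopy (E : SimplicialObject (AbObj (Over X))) (m : ℕ) :
    ((alternatingFaceMapComplex _).obj (fibresObj E)).homology m ⟶ (homotopy X m).obj E :=
  HomologicalComplex.homologyMap (DoldKan.PInftyToNormalizedMooreComplex (fibresObj E)) m

instance (m : ℕ) : IsIso (homologyToHomotopy E m) :=
  ((DoldKan.homotopyEquivNormalizedMooreComplexAlternatingFaceMapComplex
    (Y := fibresObj E)).symm.toHomologyIso m).isIso_hom

lemma homologyToHomotopy_naturality (e : E ⟶ E') (m : ℕ) :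
    HomologicalComplex.homologyMap ((alternatingFaceMapComplex _).map
      (((SimplicialObject.whiskering _ _).obj (fibres X)).map e)) m ≫ homologyToHomotopy E' m =
      homologyToHomotopy E m ≫ (homotopy X m).map e := by
  refine (HomologicalComplex.homologyMap_comp _ _ m).symm.trans ?_
  refine Eq.trans ?_ (HomologicalComplex.homologyMap_comp _ _ m)
  exact congrArg (fun f => HomologicalComplex.homologyMap f m)
    (DoldKan.PInftyToNormalizedMooreComplex_naturality _)

/-- A cohomology class and a homotopy class of maps to an Eilenberg–Mac Lane object correspond if
they have representatives that do. -/
def Corresponds {n : ℕ} {G : AbObj (Over X)} (V : SimplicialObject (Over X))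
    (E : EilenbergMacLane X G n) (x : derivedCohomology n V G) (y : mapComponents V E.obj) : Prop :=
  ∃ (c : (homComplex V G).X n) (z : (mapGroup V E.obj) _⦋0⦌),
    IsCocycleOf (homComplex V G) x c ∧ component (mapGroup V E.obj) z = y ∧
    Represents (homologyToHomotopy E.obj n ≫ E.iso.hom) (cochainEquiv V G n c)
      (vertexChainMap V E.obj z)

/-- Representatives on both sides are carried along by `a`, `g` and `e`; the hypothesis `he` matches
the identifications of `π_n` with the coefficients. -/
lemma Corresponds.map {n : ℕ} {G G' : AbObj (Over X)} {E : EilenbergMacLane X G n}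
    {E' : EilenbergMacLane X G' n} (a : V ⟶ V') {g : G ⟶ G'} {e : E.obj ⟶ E'.obj}
    (he : (homotopy X n).map e ≫ E'.iso.hom = E.iso.hom ≫ (fibres X).map g)
    {x : derivedCohomology n V' G} {y : mapComponents V' E.obj} (h : Corresponds V' E x y) :
    Corresponds V E' (derivedCohomologyMap n a g x) (mapComponentsMap a e y) := by
  obtain ⟨c, z, hc, rfl, hz⟩ := h
  refine ⟨_, (mapGroupMap a e).app (op ⦋0⦌) z, hc.map _, rfl, ?_⟩
  rw [cochainEquiv_map, vertexChainMap_mapGroupMap]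
  refine hz.comp _ _ _ ?_
  rw [← Category.assoc, homologyToHomotopy_naturality, Category.assoc, he, Category.assoc]

/-- Totality on the two sides comes from `exists_represented` and `exists_represents`;
`Represents.coboundary_iff` says that zero is related only to zero. Characterising `η` by
`Corresponds` makes it independent of choices. -/
lemma exists_addEquiv_of_isRetractOfSum (hV : ∀ k, IsRetractOfSum (V _⦋k⦌)) {m : ℕ}
    {G : AbObj (Over X)} (E : EilenbergMacLane X G (m + 1)) :
    ∃ η : derivedCohomology (m + 1) V G ≃+ mapComponents V E.obj,
      ∀ x y, Corresponds V E x y ↔ η x = y := by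
  have hVE : LiftsAgainst ((alternatingFaceMapComplex _).obj (freeFibresObj V))
      ((alternatingFaceMapComplex _).obj (fibresObj E.obj)) (m + 1) :=
    liftsAgainst _ (fun p => ⟨_, hV p, rfl⟩) (fun q => .fibres _)
      ((IsProductPreserving.fibres G).of_iso
        (asIso (homologyToHomotopy E.obj (m + 1)) ≪≫ E.iso).symm)
      (fun q hq => (E.isZero q hq).of_iso (asIso (homologyToHomotopy E.obj q)))
  apply exists_addEquiv_of_relation
  · rintro _ _ _ _ ⟨c, z, hc, rfl, hz⟩ ⟨c', z', hc', rfl, hz'⟩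
    refine ⟨c - c', z - z', hc.sub hc', ?_, ?_⟩
    · rw [sub_eq_add_neg, sub_eq_add_neg]
      rfl
    · rw [map_sub, map_sub]
      exact hz.sub hz'
  · intro x
    obtain ⟨c, hc⟩ := exists_isCocycleOf x
    obtain ⟨φ, hφ⟩ := exists_represented hVE
      (γ := homologyToHomotopy E.obj (m + 1) ≫ E.iso.hom) (cochainEquiv V G _ c) (by
        rw [← cochainEquiv_d, hc.d_eq_zero, map_zero])
    obtain ⟨z, ⟨H⟩⟩ := exists_vertexChainMap_homotopic φ
    exact ⟨_, c, z, hc, rfl, hφ.of_homotopy H⟩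
  · intro y
    induction y using component_ind with | _ z
    obtain ⟨c, hc⟩ := exists_represents (γ := homologyToHomotopy E.obj (m + 1) ≫ E.iso.hom) hVE
      (vertexChainMap V E.obj z)
    obtain ⟨c, rfl⟩ := (cochainEquiv V G _).surjective c
    obtain ⟨x, hx⟩ := exists_isCocycleOf_of_d_eq_zero (D := homComplex V G) (c := c) (by
      apply (cochainEquiv V G _).injective
      rw [cochainEquiv_d, hc.d_comp, map_zero])
    exact ⟨x, c, z, hx, rfl, hc⟩
  · rintro _ _ ⟨c, z, hc, rfl, hz⟩
    rw [component_eq_zero_iff, ← hz.coboundary_iff hVE]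
    refine (IsCocycleOf.eq_zero_iff hc).trans ?_
    constructor
    · rintro ⟨b, rfl⟩
      exact ⟨_, (cochainEquiv_d b).symm⟩
    · rintro ⟨b, hb⟩
      obtain ⟨b, rfl⟩ := (cochainEquiv V G _).surjective b
      exact ⟨b, (cochainEquiv V G _).injective ((cochainEquiv_d b).trans hb)⟩

end ThetaAlg

/-! ### The additive category of abelian group objects -/

namespace AbObj

variable {C : Type u} [Category.{v} C]

lemma comp_zero {Y Y' : C} (G : AbObj C) (f : Y' ⟶ Y) : f ≫ (0 : Y ⟶ G.obj) = 0 := by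
  have h := G.comp_add f 0 0
  rwa [add_zero, left_eq_add] at h

lemma comp_neg {Y Y' : C} (G : AbObj C) (f : Y' ⟶ Y) (a : Y ⟶ G.obj) : f ≫ (-a) = -(f ≫ a) := by
  have h := G.comp_add f (-a) a
  rw [neg_add_cancel, comp_zero] at h
  exact eq_neg_of_add_eq_zero_left h.symm

variable {G H : AbObj C}

instance : Add (G ⟶ H) := ⟨fun f g => ⟨f.hom + g.hom, fun a b => by
  rw [H.comp_add, H.comp_add, H.comp_add, f.add_comp, g.add_comp]
  exact add_add_add_comm _ _ _ _⟩⟩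

instance : Zero (G ⟶ H) := ⟨⟨0, fun a b => by
  rw [comp_zero, comp_zero, comp_zero, add_zero]⟩⟩

instance : Neg (G ⟶ H) := ⟨fun f => ⟨-f.hom, fun a b => by
  rw [comp_neg, comp_neg, comp_neg, f.add_comp, neg_add]⟩⟩

instance : AddCommGroup (G ⟶ H) where
  nsmul := nsmulRec
  zsmul := zsmulRec
  add_assoc f g h := hom_ext (add_assoc _ _ _)
  zero_add f := hom_ext (zero_add _)
  add_zero f := hom_ext (add_zero _)
  neg_add_cancel f := hom_ext (neg_add_cancel _)
  add_comm f g := hom_ext (add_comm _ _)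

instance : Preadditive (AbObj C) where
  add_comp _ _ _ f f' g := hom_ext (g.add_comp _ _)
  comp_add _ _ K f g g' := hom_ext (K.comp_add _ _ _)

section Products

variable {J : Type*} [HasProductsOfShape J C] (F : J → AbObj C)

/-- Maps to a product are families of maps. -/
def toProductEquiv (Y : C) : (Y ⟶ ∏ᶜ fun j => (F j).obj) ≃ ∀ j, Y ⟶ (F j).obj where
  toFun a j := a ≫ Pi.π _ j
  invFun := Pi.lift
  left_inv a := by ext; simp
  right_inv a := by ext; simp

/-- The product of abelian group objects. -/
def product : AbObj C where
  obj := ∏ᶜ fun j => (F j).obj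
  grp Y := (toProductEquiv F Y).addCommGroup
  comp_add {Y Y'} f a b := by
    let _ (Y : C) : AddCommGroup (Y ⟶ ∏ᶜ fun j => (F j).obj) := (toProductEquiv F Y).addCommGroup
    apply (toProductEquiv F Y').injective
    refine Eq.trans ?_ ((toProductEquiv F Y').apply_symm_apply _).symm
    funext j
    have h := congrFun ((toProductEquiv F Y).apply_symm_apply
      (toProductEquiv F Y a + toProductEquiv F Y b)) j
    change (f ≫ (a + b)) ≫ Pi.π _ j = (f ≫ a) ≫ Pi.π _ j + (f ≫ b) ≫ Pi.π _ j
    rw [Category.assoc, Category.assoc, Category.assoc, ← (F j).comp_add]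
    exact congrArg _ h

/-- The projections of the product of abelian group objects. -/
def productFan : Fan F := Fan.mk (product F) fun j => ⟨Pi.π _ j, fun {Y} a b =>
  congrFun ((toProductEquiv F Y).apply_symm_apply
    (toProductEquiv F Y a + toProductEquiv F Y b)) j⟩

lemma product_hom_ext {Y : C} {a b : Y ⟶ (product F).obj}
    (h : ∀ j, a ≫ ((productFan F).proj j).hom = b ≫ ((productFan F).proj j).hom) : a = b :=
  (toProductEquiv F Y).injective (funext h)

/-- The universal property of the product of abelian group objects. -/
def isLimitProductFan : IsLimit (productFan F) :=
  Fan.IsLimit.mk _ (fun s => ⟨Pi.lift fun j => (s.proj j).hom, fun a b => by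
      apply product_hom_ext
      intro j
      have h {Y : C} (c : Y ⟶ s.pt.obj) : (show Y ⟶ (product F).obj from
          c ≫ Pi.lift fun j => (s.proj j).hom) ≫ ((productFan F).proj j).hom =
          c ≫ (s.proj j).hom :=
        (Category.assoc _ _ _).trans (congrArg _ (Pi.lift_π _ _))
      refine (h (a + b)).trans (((s.proj j).add_comp a b).trans ?_)
      rw [← h a, ← h b]
      exact (((productFan F).proj j).add_comp _ _).symm⟩)
    (fun s j => hom_ext (Pi.lift_π (fun j => (s.proj j).hom) j))
    (fun s m hm => hom_ext (product_hom_ext F fun j => by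
      refine (congrArg Hom.hom (hm j)).trans ?_
      exact (Pi.lift_π (fun j => (s.proj j).hom) j).symm))

instance : HasProductsOfShape J (AbObj C) where
  has_limit F :=
    have : HasLimit (Discrete.functor (F.obj ∘ Discrete.mk)) := ⟨⟨_, isLimitProductFan _⟩⟩
    hasLimit_of_iso Discrete.natIsoFunctor.symm

end Products

instance [HasFiniteProducts C] : HasFiniteProducts (AbObj C) := ⟨fun _ => inferInstance⟩

instance [HasFiniteProducts C] : HasFiniteBiproducts (AbObj C) :=
  HasFiniteBiproducts.of_hasFiniteProducts

instance [HasFiniteProducts C] : HasZeroObject (AbObj C) :=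
  hasZeroObject_of_hasTerminal_object

end AbObj

/-! ### Finite products of algebras over `X` -/

namespace ThetaAlg

variable {Θ : Type w} [SmallCategory Θ]

/-- Limits of functors are computed objectwise and commute with products: the limit is the flipped
diagram followed by `lim`, and both preserve finite products. -/
lemma preservesFiniteProducts_isClosedUnderLimitsOfShape (K : Type) [SmallCategory K] :
    ObjectProperty.IsClosedUnderLimitsOfShape
      (fun A : Θ ⥤ Type w => PreservesFiniteProducts A) K where
  limitsOfShape_le := by
    rintro A ⟨h⟩
    have := h.prop_diag_obj
    have : PreservesFiniteProducts h.diag.flip := ⟨fun n => ⟨fun {F} => ⟨fun {c} hc =>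
      ⟨evaluationJointlyReflectsLimits _ fun k =>
        have : PreservesFiniteProducts (h.diag.obj k) := this k
        isLimitOfPreserves (h.diag.obj k) hc⟩⟩⟩⟩
    let e : h.diag.flip ⋙ lim ≅ A := (limitIsoFlipCompLim h.diag).symm ≪≫
      (limit.isLimit h.diag).conePointUniqueUpToIso h.isLimit
    exact ⟨fun n => preservesLimitsOfShape_of_natIso e⟩

instance (X : ThetaAlg Θ) : HasFiniteProducts (Over X) := by
  have := preservesFiniteProducts_isClosedUnderLimitsOfShape (Θ := Θ) WalkingCospan
  have : HasPullbacks (ThetaAlg Θ) := inferInstance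
  -- Binary products over `X` are pullbacks over `X`, and the identity of `X` is terminal.
  have := Over.ConstructProducts.over_binaryProduct_of_pullback (B := X)
  have := Over.over_hasTerminal X
  exact hasFiniteProducts_of_has_binary_and_terminal

end ThetaAlg

/-! ### Eilenberg–Mac Lane objects from the inverse Dold–Kan functor -/

section DoldKan

open AlgebraicTopology DoldKan

variable {A B : Type*} [Category* A] [Category* B] [Preadditive A] [HasFiniteCoproducts A]
  [Abelian B]
  (F : A ⥤ B) [F.Additive]

/-- The inclusion of a chain complex in the complex of the associated simplicial object. -/
def toChainsΓ₀ : 𝟭 (ChainComplex A ℕ) ⟶ Γ₀ ⋙ alternatingFaceMapComplex A where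
  app K := (N₁Γ₀.inv.app K).f
  naturality K L f := by
    refine (congrArg Idempotents.Karoubi.Hom.f (N₁Γ₀.inv.naturality f)).trans ?_
    refine (Category.assoc _ _ _).symm.trans ?_
    exact congrArg (· ≫ _) (Idempotents.Karoubi.comp_p (N₁Γ₀.inv.app K))

lemma toChainsΓ₀_comp (K : ChainComplex A ℕ) :
    toChainsΓ₀.app K ≫ (N₁Γ₀.hom.app K).f = 𝟙 K :=
  congrArg Idempotents.Karoubi.Hom.f (N₁Γ₀.inv_hom_id_app K)

/-- The identity of `N₁.obj (Γ₀.obj K)` in the Karoubi envelope is `PInfty`, so the composite is the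
identity only up to homotopy. -/
lemma comp_toChainsΓ₀ (K : ChainComplex A ℕ) :
    (N₁Γ₀.hom.app K).f ≫ toChainsΓ₀.app K = (PInfty : K[Γ₀.obj K] ⟶ _) :=
  congrArg Idempotents.Karoubi.Hom.f (N₁Γ₀.hom_inv_id_app K)

/-- A chain complex is homotopy equivalent to the complex of the associated simplicial object. -/
def homotopyEquivΓ₀ (K : ChainComplex A ℕ) : HomotopyEquiv K K[Γ₀.obj K] where
  hom := toChainsΓ₀.app K
  inv := (N₁Γ₀.hom.app K).f
  homotopyHomInvId := Homotopy.ofEq (toChainsΓ₀_comp K)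
  homotopyInvHomId := (Homotopy.ofEq (comp_toChainsΓ₀ K)).trans (homotopyPInftyToId _)

/-- An additive functor commutes with the construction of simplicial objects from chain complexes,
on homology. -/
def homologyΓ₀Iso (m : ℕ) :
    F.mapHomologicalComplex (ComplexShape.down ℕ) ⋙ HomologicalComplex.homologyFunctor _ _ m ≅
    (Γ₀ ⋙ (SimplicialObject.whiskering A B).obj F) ⋙ alternatingFaceMapComplex B ⋙
      HomologicalComplex.homologyFunctor _ _ m :=
  (show _ ≅ (Γ₀ ⋙ alternatingFaceMapComplex A ⋙
      F.mapHomologicalComplex (ComplexShape.down ℕ)) ⋙ HomologicalComplex.homologyFunctor _ _ m from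
    -- An additive functor preserves homotopy equivalences; it also commutes with alternating face
    -- map complexes, which is the `eqToIso` below.
    NatIso.ofComponents (fun K => (F.mapHomotopyEquiv (homotopyEquivΓ₀ K)).toHomologyIso m)
    (fun f => by
      refine (HomologicalComplex.homologyMap_comp _ _ m).symm.trans ?_
      refine Eq.trans ?_ (HomologicalComplex.homologyMap_comp _ _ m)
      refine congrArg (fun f => HomologicalComplex.homologyMap f m) ?_
      exact ((F.mapHomologicalComplex _).map_comp _ _).symm.trans
        ((congrArg (F.mapHomologicalComplex _).map (toChainsΓ₀.naturality f)).trans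
          ((F.mapHomologicalComplex _).map_comp _ _))))
    ≪≫ Functor.isoWhiskerRight (Functor.isoWhiskerLeft Γ₀
      (eqToIso (map_alternatingFaceMapComplex F))) (HomologicalComplex.homologyFunctor _ _ m)

end DoldKan

namespace ThetaAlg

open AlgebraicTopology

variable {Θ : Type w} [SmallCategory Θ] (X : ThetaAlg Θ)

instance : (fibres X).Additive where
  map_add {G H f g} := by
    ext e a
    exact H.comp_add _ _ _

/-- The homotopy groups are the homology groups of the alternating face map complex. -/
def homologyIsoHomotopy (m : ℕ) :
    (SimplicialObject.whiskering _ _).obj (fibres X) ⋙ alternatingFaceMapComplex _ ⋙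
      HomologicalComplex.homologyFunctor _ _ m ≅ homotopy X m :=
  NatIso.ofComponents (fun E => (asIso (homologyToHomotopy E m) :))
    (fun e => homologyToHomotopy_naturality e m)

/-- The functor sending an abelian group object to the associated extended Eilenberg–Mac Lane
object. -/
def eilenbergMacLane (n : ℕ) : AbObj (Over X) ⥤ SimplicialObject (AbObj (Over X)) :=
  HomologicalComplex.single _ (ComplexShape.down ℕ) n ⋙ DoldKan.Γ₀

/-- The homotopy groups of Eilenberg–Mac Lane objects. -/
def eilenbergMacLaneHomotopyIso (n m : ℕ) :
    eilenbergMacLane X n ⋙ homotopy X m ≅ fibres X ⋙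
      HomologicalComplex.single _ (ComplexShape.down ℕ) n ⋙
        HomologicalComplex.homologyFunctor _ _ m :=
  Functor.isoWhiskerLeft (eilenbergMacLane X n) (homologyIsoHomotopy X m).symm ≪≫
    Functor.isoWhiskerLeft (HomologicalComplex.single _ (ComplexShape.down ℕ) n)
      (homologyΓ₀Iso (fibres X) m).symm ≪≫
    Functor.isoWhiskerRight
      (HomologicalComplex.singleMapHomologicalComplex (fibres X) (ComplexShape.down ℕ) n)
      (HomologicalComplex.homologyFunctor _ _ m)

end ThetaAlg

end

theorem proposition4p11 {Θ : Type w} [SmallCategory Θ] [CartesianMonoidalCategory Θ]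
    (T : GroupTheory Θ) (X : ThetaAlg Θ) (n : ℕ) (hn : 1 ≤ n) :
    -- there is a functor `E(-, n)` of extended Eilenberg–Mac Lane objects
    (∃ E : AbObj (Over X) ⥤ SimplicialObject (AbObj (Over X)),
      Nonempty (E ⋙ ThetaAlg.homotopy X n ≅ ThetaAlg.fibres X) ∧
      ∀ (m : ℕ) (G : AbObj (Over X)), m ≠ n → IsZero ((ThetaAlg.homotopy X m).obj (E.obj G))) ∧
    -- the two cohomology groups are isomorphic, naturally in the resolution and the coefficients
    ∃ η : ∀ {Y : SimplicialObject (Over X)} (R : T.Resolution Y) {G : AbObj (Over X)}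
        (E : ThetaAlg.EilenbergMacLane X G n),
        derivedCohomology n R.V G ≃+ mapComponents R.V E.obj,
      ∀ {Y Y' : SimplicialObject (Over X)} (R : T.Resolution Y) (R' : T.Resolution Y')
        (a : R.V ⟶ R'.V) {G G' : AbObj (Over X)} (E : ThetaAlg.EilenbergMacLane X G n)
        (E' : ThetaAlg.EilenbergMacLane X G' n) (g : G ⟶ G') (e : E.obj ⟶ E'.obj),
        (ThetaAlg.homotopy X n).map e ≫ E'.iso.hom = E.iso.hom ≫ (ThetaAlg.fibres X).map g →
        ∀ c : derivedCohomology n R'.V G,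
          η R E' (derivedCohomologyMap n a g c) = mapComponentsMap a e (η R' E c) := by
  constructor
  · refine ⟨ThetaAlg.eilenbergMacLane X n, ⟨ThetaAlg.eilenbergMacLaneHomotopyIso X n n ≪≫
      Functor.isoWhiskerLeft _ (HomologicalComplex.homologyFunctorSingleIso _ _ n)⟩, ?_⟩
    intro m G hm
    exact (HomologicalComplex.isZero_single_obj_homology _ n
      ((ThetaAlg.fibres X).obj G) m hm).of_iso
      ((ThetaAlg.eilenbergMacLaneHomotopyIso X n m).app G)
  -- Coboundaries come from degree `n - 1`, so `n` is written as a successor.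
  · obtain ⟨m, rfl⟩ : ∃ m, n = m + 1 := ⟨n - 1, by omega⟩
    have H {Y : SimplicialObject (Over X)} (R : T.Resolution Y) {G : AbObj (Over X)}
        (E : ThetaAlg.EilenbergMacLane X G (m + 1)) :=
      ThetaAlg.exists_addEquiv_of_isRetractOfSum (fun k => R.isCofibrant.isRetractOfSum k) E
    choose η hη using @H
    refine ⟨η, fun {_ _} R R' a {_ _} E E' g e he c => ?_⟩
    -- Both isomorphisms are graphs of `Corresponds`, so naturality is the fact that maps preserve
    -- this relation.
    exact (hη R E' _ _).1 (ThetaAlg.Corresponds.map a he ((hη R' E _ _).2 rfl))
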